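/- **Conventions.** For a triangulated category $\mathcal T$ with suspension $\Sigma$, the graded center $Z^*(\mathcal T)=\bigoplus_{n\in\mathbb Z}Z^n(\mathcal T)$ is the graded ring whose degree $n$ part consists of all natural transformations $\eta\colon \mathrm{id}\to\Sigma^n$ with $\eta\Sigma=(-1)^n\Sigma\eta$, with multiplication given by composition. For a commutative ring $A$ and an $A$-module $M$, the trivial extension $T(A,M)$ is the graded ring $A\oplus M$ with $A$ in degree $0$, $M$ in degree $1$ and $(a,m)(a',m')=(aa',am'+a'm)$. For a maximal ideal $\mathfrak p$ of $R$ write $k_{\mathfrak p}=R/\mathfrak p$, considered as a simple $R$-module. $\operatorname{mod}(R)$ is the category of finitely generated $R$-modules, and $\mathcal H_{\mathfrak p}$ its full subcategory of $\mathfrak p$-torsion modules (every element is annihilated by a power of $\mathfrak p$). A module $M$ is identified with the stalk complex $M$ in degree $0$, and a short exact sequence $0\to M'\to E\to M\to 0$ with its class in $\operatorname{Ext}^1_R(M,M')=\operatorname{Hom}_{D^b(\operatorname{mod}(R))}(M,\Sigma M')$. **Proposition.** Let $R$ be a Dedekind domain and let $\operatorname{Max}(R)$ be the set of its nonzero maximal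 ideals (these are all maximal ideals, unless $R$ is a field). For each $\mathfrak p\in\operatorname{Max}(R)$ fix an element $x_{\mathfrak p}\in\mathfrak p\setminus\mathfrak p^2$. Then for all $\mathfrak p\in\operatorname{Max}(R)$ and $l\ge 1$ the sequence $$\sigma^l_{\mathfrak p}\colon\quad 0\to R/\mathfrak p^{l}\xrightarrow{\;a\mapsto(a,\,x_{\mathfrak p}a)\;} R/\mathfrak p^{l-1}\oplus R/\mathfrak p^{l+1}\xrightarrow{\;(b,c)\mapsto c-x_{\mathfrak p}b\;} R/\mathfrak p^{l}\to 0$$ (where $R/\mathfrak p^{0}=0$) is an Auslander–Reiten sequence in $\mathcal H_{\mathfrak p}$, and there is an isomorphism of graded rings $$Z^*(D^b(\operatorname{mod}(R)))\;\cong\; T\Bigl(R,\ \prod_{\mathfrak p\in\operatorname{Max}(R)}\ \prod_{l\ge 1}k_{\mathfrak p}\Bigr).$$ In particular $Z^*(D^b(\operatorname{mod}(R)))$ is concentrated in degrees $0$ and $1$. The isomorphism can be chosen such that a degree $0$ element corresponding to $r\in R$ is given on every object $X$ by multiplication with $r$, and a degree $1$ element $\eta$ corresponding to $(\lambda_{\mathfrak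 p,l})_{\mathfrak p,l}$ satisfies $\eta_{R/\mathfrak p^l}=\lambda_{\mathfrak p,l}\,\sigma^l_{\mathfrak p}$ for all $\mathfrak p\in\operatorname{Max}(R)$ and $l\ge1$. -/

import Mathlib

open CategoryTheory

universe w v u

noncomputable section

namespace KrauseYe

set_option linter.unusedSectionVars false

section GradedCenter

/-! ## The graded center of a graded category -/

variable (C : Type u) [Category.{v} C] [Preadditive C] [HasShift C ℤ]
  [∀ n : ℤ, (shiftFunctor C n).Additive]

/-- The degree `n` part `Zⁿ(C)` of the graded center: all natural transformations
`η : id ⟶ Σⁿ` such that `η Σ = (-1)ⁿ Σ η`, where `Σ = ⟦1⟧` and the canonical isomorphism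
`Σ Σⁿ ≅ Σⁿ Σ` is used to compare both sides. -/
def centerDegree (n : ℤ) : AddSubgroup (𝟭 C ⟶ shiftFunctor C n) where
  carrier := {η | ∀ X : C, η.app (X⟦(1 : ℤ)⟧) =
    n.negOnePow • ((η.app X)⟦(1 : ℤ)⟧' ≫ (shiftFunctorComm C n 1).hom.app X)}
  zero_mem' X := by simp
  add_mem' {a b} ha hb X := by
    have ha := ha X
    have hb := hb X
    simp only [NatTrans.app_add, Functor.map_add, Preadditive.add_comp, smul_add] at ha hb ⊢
    rw [ha, hb]
  neg_mem' {a} ha X := by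
    have ha := ha X
    simp only [NatTrans.app_neg, Functor.map_neg, Preadditive.neg_comp, smul_neg] at ha ⊢
    rw [ha]

variable {C}

/-- The component `η_X : X ⟶ Σⁿ X`. -/
def centerApp {n : ℤ} (η : centerDegree C n) (X : C) : ShiftedHom X X n := η.1.app X

lemma centerApp_naturality {n : ℤ} (η : centerDegree C n) {X Y : C} (f : X ⟶ Y) :
    f ≫ centerApp η Y = centerApp η X ≫ f⟦n⟧' :=
  η.1.naturality f

lemma centerApp_shift {n : ℤ} (η : centerDegree C n) (X : C) :
    centerApp η (X⟦(1 : ℤ)⟧) =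
      n.negOnePow • ((centerApp η X)⟦(1 : ℤ)⟧' ≫ (shiftFunctorComm C n 1).hom.app X) :=
  η.2 X

@[ext]
lemma centerDegree_ext {n : ℤ} {η ζ : centerDegree C n}
    (h : ∀ X, centerApp η X = centerApp ζ X) : η = ζ := by
  apply Subtype.ext
  ext X
  exact h X

lemma shift_comp_comm {m n c : ℤ} (h : m + n = c) {X : C} (f : ShiftedHom X X n)
    (g : ShiftedHom X X m) :
    (f.comp g h)⟦(1 : ℤ)⟧' ≫ (shiftFunctorComm C c 1).hom.app X =
      ShiftedHom.comp (f⟦(1 : ℤ)⟧' ≫ (shiftFunctorComm C n 1).hom.app X)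
        (g⟦(1 : ℤ)⟧' ≫ (shiftFunctorComm C m 1).hom.app X) h := by
  have key : ((shiftFunctorAdd' C m n c h).inv.app X)⟦(1 : ℤ)⟧' ≫
      (shiftFunctorComm C c 1).hom.app X =
      (shiftFunctorComm C n 1).hom.app (X⟦m⟧) ≫ ((shiftFunctorComm C m 1).hom.app X)⟦n⟧' ≫
        (shiftFunctorAdd' C m n c h).inv.app (X⟦(1 : ℤ)⟧) := by
    subst h
    rw [shiftFunctorAdd'_eq_shiftFunctorAdd]
    have h₁ := shiftFunctorComm_hom_app_comp_shift_shiftFunctorAdd_hom_app (1 : ℤ) m n X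
    rw [← shiftFunctorComm_symm C m 1, ← shiftFunctorComm_symm C n 1,
      ← shiftFunctorComm_symm C (m + n) 1] at h₁
    simp only [Iso.symm_hom] at h₁
    rw [← cancel_epi (((shiftFunctorAdd C m n).hom.app X)⟦(1 : ℤ)⟧'),
      ← Functor.map_comp_assoc, Iso.hom_inv_id_app, CategoryTheory.Functor.map_id, Category.id_comp,
      ← cancel_epi ((shiftFunctorComm C (m + n) 1).inv.app X), Iso.inv_hom_id_app,
      reassoc_of% h₁, Iso.inv_hom_id_app_assoc, ← Functor.map_comp_assoc, Iso.inv_hom_id_app]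
    dsimp
    rw [CategoryTheory.Functor.map_id, Category.id_comp]
    exact ((shiftFunctorAdd C m n).hom_inv_id_app (X⟦(1 : ℤ)⟧)).symm
  have nat := (shiftFunctorComm C n 1).hom.naturality g
  dsimp at nat
  simp only [ShiftedHom.comp, Functor.map_comp, Category.assoc, key]
  rw [reassoc_of% nat]

lemma smul_comp_smul {a b c : ℤ} {X Y Z : C} (u w : ℤˣ) (f : ShiftedHom X Y a)
    (g : ShiftedHom Y Z b) (h : b + a = c) :
    ShiftedHom.comp (u • f) (w • g) h = (u * w) • f.comp g h := by
  rcases Int.units_eq_one_or u with rfl | rfl <;> rcases Int.units_eq_one_or w with rfl | rfl <;>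
    simp

/-- The product of `η ∈ Zᵐ` and `ζ ∈ Zⁿ`, with `(η ζ)_X` the composition
`X ⟶ Σⁿ X ⟶ Σⁿ Σᵐ X = Σᵐ⁺ⁿ X` of `ζ_X` and `Σⁿ (η_X)`. This is the product for which
`Z*(C) → Ext*(X, X)`, `η ↦ η_X`, is multiplicative. -/
def centerMul {m n c : ℤ} (h : m + n = c) (η : centerDegree C m) (ζ : centerDegree C n) :
    centerDegree C c :=
  ⟨{ app := fun X => (centerApp ζ X).comp (centerApp η X) h
     naturality := fun X Y f => by
      have h₁ := centerApp_naturality ζ f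
      have h₂ := centerApp_naturality η f
      have h₃ := (shiftFunctorAdd' C m n c h).inv.naturality f
      dsimp at h₃ ⊢
      simp only [ShiftedHom.comp, Category.assoc, reassoc_of% h₁, ← h₃,
        ← Functor.map_comp_assoc, ← h₂] }, fun X => by
      change (centerApp ζ _).comp (centerApp η _) h = _ • (((centerApp ζ X).comp
        (centerApp η X) h)⟦(1 : ℤ)⟧' ≫ _)
      rw [shift_comp_comm, centerApp_shift, centerApp_shift, smul_comp_smul]
      congr 1
      rw [← h, Int.negOnePow_add, mul_comm]⟩

/-- The unit of the graded center. -/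
def centerOne : centerDegree C 0 :=
  ⟨{ app := fun X => ShiftedHom.mk₀ (0 : ℤ) rfl (𝟙 X)
     naturality := fun X Y f => by
      have := (shiftFunctorZero C ℤ).inv.naturality f
      dsimp at this ⊢
      simp [ShiftedHom.mk₀, shiftFunctorZero', this] }, fun X => by
      change ShiftedHom.mk₀ (0 : ℤ) rfl (𝟙 _) = _ • ((ShiftedHom.mk₀ (0 : ℤ) rfl (𝟙 X))⟦(1 : ℤ)⟧' ≫ _)
      have := shiftFunctorZero_inv_app_shift (A := ℤ) (X := X) (1 : ℤ)
      rw [← shiftFunctorComm_symm C 0 1] at this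
      simpa [ShiftedHom.mk₀, shiftFunctorZero'] using this⟩

lemma centerApp_mul {m n c : ℤ} (h : m + n = c) (η : centerDegree C m) (ζ : centerDegree C n)
    (X : C) : centerApp (centerMul h η ζ) X = (centerApp ζ X).comp (centerApp η X) h := rfl

lemma centerApp_one (X : C) :
    centerApp (centerOne : centerDegree C 0) X = ShiftedHom.mk₀ (0 : ℤ) rfl (𝟙 X) := rfl

lemma centerApp_add {n : ℤ} (η ζ : centerDegree C n) (X : C) :
    centerApp (η + ζ) X = centerApp η X + centerApp ζ X := rfl

lemma centerApp_zero {n : ℤ} (X : C) : centerApp (0 : centerDegree C n) X = 0 := rfl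

/-- An element of degree `n`, as a homogeneous element. -/
abbrev homog (n : ℤ) (η : centerDegree C n) : GradedMonoid fun n : ℤ => centerDegree C n :=
  GradedMonoid.mk n η

instance : GradedMonoid.GMul (fun n : ℤ => centerDegree C n) where
  mul η ζ := centerMul rfl η ζ

instance : GradedMonoid.GOne (fun n : ℤ => centerDegree C n) where
  one := centerOne

lemma homog_centerMul {m n c : ℤ} (h : m + n = c) (η : centerDegree C m)
    (ζ : centerDegree C n) :
    homog c (centerMul h η ζ) =
      homog m η * homog n ζ := by
  subst h
  rfl

/-- The multiplication makes `⨁ₙ Zⁿ(C)` a graded ring. -/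
instance : DirectSum.GRing (fun n : ℤ => centerDegree C n) where
  mul_zero a := by
    apply centerDegree_ext
    intro X
    exact ShiftedHom.zero_comp _ _ _ _
  zero_mul b := by
    apply centerDegree_ext
    intro X
    exact ShiftedHom.comp_zero _ _ _
  mul_add a b c := by
    apply centerDegree_ext
    intro X
    exact ShiftedHom.add_comp _ _ _ _
  add_mul a b c := by
    apply centerDegree_ext
    intro X
    exact ShiftedHom.comp_add _ _ _ _
  one_mul := by
    rintro ⟨n, η⟩
    change homog 0 centerOne * homog n η = _
    rw [← homog_centerMul (zero_add n)]
    congr 1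
    apply centerDegree_ext
    intro X
    exact ShiftedHom.comp_mk₀_id _ _ _
  mul_one := by
    rintro ⟨n, η⟩
    change homog n η * homog 0 centerOne = _
    rw [← homog_centerMul (add_zero n)]
    congr 1
    apply centerDegree_ext
    intro X
    exact ShiftedHom.mk₀_id_comp _ _ _
  mul_assoc := by
    rintro ⟨a, η⟩ ⟨b, ζ⟩ ⟨c, ξ⟩
    change homog a η * homog b ζ * homog c ξ =
      homog a η * (homog b ζ * homog c ξ)
    rw [← homog_centerMul rfl ζ ξ, ← homog_centerMul (add_assoc a b c).symm,
      ← homog_centerMul rfl η ζ, ← homog_centerMul rfl]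
    congr 1
    apply centerDegree_ext
    intro X
    exact (ShiftedHom.comp_assoc _ _ _ rfl rfl rfl).symm
  natCast n := n • centerOne
  natCast_zero := zero_smul _ _
  natCast_succ n := succ_nsmul _ _
  intCast n := n • centerOne
  intCast_ofNat n := natCast_zsmul _ _
  intCast_negSucc_ofNat n := negSucc_zsmul _ _

variable (C)

/-- The graded center `Z*(C) = ⨁ₙ Zⁿ(C)`. -/
abbrev GradedCenter : Type (max u v) := DirectSum ℤ fun n => centerDegree C n

variable {C} in
/-- The inclusion `Zⁿ(C) ⟶ Z*(C)`. -/
abbrev GradedCenter.of (n : ℤ) : centerDegree C n →+ GradedCenter C :=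
  DirectSum.of (fun n : ℤ => centerDegree C n) n

end GradedCenter

section TrivialExtension

/-! ## The trivial extension as a graded ring -/

/-- The degree `n` part of the trivial extension `T(A, M) = A ⊕ M`: it is `A` for `n = 0`,
`M` for `n = 1`, and zero otherwise. -/
def trivExtDegree (A M : Type*) [AddCommGroup A] [AddCommGroup M] (n : ℤ) :
    AddSubgroup (TrivSqZeroExt A M) where
  carrier := {t | (n ≠ 0 → t.fst = 0) ∧ (n ≠ 1 → t.snd = 0)}
  zero_mem' := by simp
  add_mem' {a b} ha hb := by
    refine ⟨fun h => ?_, fun h => ?_⟩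
    · simp [ha.1 h, hb.1 h]
    · simp [ha.2 h, hb.2 h]
  neg_mem' {a} ha := by
    refine ⟨fun h => ?_, fun h => ?_⟩
    · simp [ha.1 h]
    · simp [ha.2 h]

end TrivialExtension

section AlmostSplit

/-! ## Auslander-Reiten sequences -/

/-- The short complex `S` is an Auslander-Reiten (almost split) sequence in the full
subcategory of objects satisfying `P`. -/
structure IsAlmostSplit {A : Type u} [Category.{v} A] [Abelian A] (P : ObjectProperty A)
    (S : ShortComplex A) : Prop where
  prop₁ : P S.X₁
  prop₂ : P S.X₂
  prop₃ : P S.X₃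
  shortExact : S.ShortExact
  not_split : ¬ Nonempty S.Splitting
  /-- every morphism in the subcategory to the right end that is not a split epimorphism
  factors through the middle term -/
  lift : ∀ (N : A), P N → ∀ h : N ⟶ S.X₃, ¬ IsSplitEpi h → ∃ h' : N ⟶ S.X₂, h' ≫ S.g = h
  /-- every morphism in the subcategory from the left end that is not a split monomorphism
  factors through the middle term -/
  desc : ∀ (N : A), P N → ∀ h : S.X₁ ⟶ N, ¬ IsSplitMono h → ∃ h' : S.X₂ ⟶ N, S.f ≫ h' = h

end AlmostSplit

section Bounded

/-! ## Stalk complexes in the bounded derived category -/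

variable {A : Type u} [Category.{v} A] [Abelian A] [HasDerivedCategory.{w} A]

/-- The object `M` of `A`, as a stalk complex in degree zero in `D^b(A)`. -/
def stalk (M : A) : DerivedCategory.Bounded A where
  obj := (DerivedCategory.singleFunctor A 0).obj M
  property := ⟨⟨0, inferInstance⟩,
    ⟨0, inferInstance⟩⟩

/-- The morphism `X₃ ⟶ Σ X₁` in `D^b(A)` which is given by a short exact sequence
`0 ⟶ X₁ ⟶ X₂ ⟶ X₃ ⟶ 0`, that is, its class in `Ext¹(X₃, X₁) = Hom(X₃, Σ X₁)`. -/
def extClass {S : ShortComplex A} (hS : S.ShortExact) :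
    ShiftedHom (stalk S.X₃) (stalk S.X₁) (1 : ℤ) :=
  ObjectProperty.homMk (hS.singleδ ≫
    ((DerivedCategory.Bounded.ι (C := A)).commShiftIso (1 : ℤ)).inv.app (stalk S.X₁))

end Bounded

section Dedekind

open IsDedekindDomain

/-- The bounded derived category `D^b(mod(R))` of finitely generated `R`-modules. -/
abbrev DbMod (R : Type u) [CommRing R] [IsNoetherianRing R]
    [HasDerivedCategory.{w} (FGModuleCat.{u} R)] : Type (u + 1) :=
  DerivedCategory.Bounded (FGModuleCat.{u} R)

/-- The `R`-module `∏_p ∏_{l ≥ 1} R/p`, where `p` runs through the nonzero prime ideals. For a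
Dedekind domain these are the nonzero maximal ideals, which are all maximal ideals unless `R`
is a field. -/
abbrev ResidueProduct (R : Type u) [CommRing R] : Type u :=
  ∀ p : HeightOneSpectrum R, ℕ+ → R ⧸ p.asIdeal

variable {R : Type u} [CommRing R]

/-- The cyclic module `R/pˡ`. -/
abbrev cyc (p : Ideal R) (l : ℕ) : Type u := R ⧸ p ^ l

/-- The `p`-torsion objects of `mod(R)`: every element is annihilated by a power of `p`. -/
def pTorsion (p : Ideal R) : ObjectProperty (FGModuleCat.{u} R) :=
  fun M => ∀ m : M, ∃ n : ℕ, ∀ a ∈ p ^ n, a • m = 0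

/-- The canonical map `R/pⁱ ⟶ R/pʲ` for `j ≤ i`. -/
def cycProj (p : Ideal R) {i j : ℕ} (h : j ≤ i) : cyc p i →ₗ[R] cyc p j :=
  Submodule.factor (Ideal.pow_le_pow_right h)

/-- For `x ∈ p` and `j ≤ i + 1`, the map `R/pⁱ ⟶ R/pʲ` which is multiplication with `x`. -/
def cycMul (p : Ideal R) {x : R} (hx : x ∈ p) {i j : ℕ} (h : j ≤ i + 1) :
    cyc p i →ₗ[R] cyc p j :=
  Submodule.mapQ (p ^ i) (p ^ j) (LinearMap.lsmul R R x) fun a ha =>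
    Ideal.pow_le_pow_right h (by
      rw [pow_succ']
      exact Ideal.mul_mem_mul hx ha)

/-- The sequence `0 ⟶ R/pˡ ⟶ R/pˡ⁻¹ ⊕ R/pˡ⁺¹ ⟶ R/pˡ ⟶ 0` for `x ∈ p` and `l ≥ 1` (where
`R/p⁰ = 0`), with first map `a ↦ (a, x a)` and second map `(b, c) ↦ c - x b`. -/
def tubeSeq [IsNoetherianRing R] (p : Ideal R) {x : R} (hx : x ∈ p) (l : ℕ) :
    ShortComplex (FGModuleCat.{u} R) where
  X₁ := FGModuleCat.of R (cyc p l)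
  X₂ := FGModuleCat.of R (cyc p (l - 1) × cyc p (l + 1))
  X₃ := FGModuleCat.of R (cyc p l)
  f := FGModuleCat.ofHom ((cycProj p (Nat.sub_le l 1)).prod (cycMul p hx le_rfl))
  g := FGModuleCat.ofHom ((cycProj p (Nat.le_succ l)).comp (LinearMap.snd R _ _) -
    (cycMul p hx (by omega)).comp (LinearMap.fst R _ _))
  zero := by
    apply FGModuleCat.hom_ext
    apply LinearMap.ext
    intro a
    obtain ⟨a, rfl⟩ := Submodule.Quotient.mk_surjective _ a
    exact sub_self (Submodule.Quotient.mk (x * a) : cyc p l)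

end Dedekind

end KrauseYe

end

open KrauseYe

noncomputable section

namespace KrauseYe

set_option linter.unusedSectionVars false

open IsDedekindDomain

/-! ### Natural transformations determined on a family of objects -/

section SumThrough

/-! The proof reduces the graded center to its components on `R` and the modules `R/pˡ`. The
reduction needs no direct sum decompositions: it suffices that the identity of each object is a
finite sum of morphisms through the chosen objects (`SumThrough`). Such a family determines natural
transformations, and a natural family on it extends (`exists_natTrans_extending`).

In `mod(R)` the family consists of `R` and all `R/pˡ` (`sumThrough_gen`), obtained by gluing the
structure theorem over the local rings. Since `mod(R)` has global dimension at most one, truncation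
triangles split, and in `D^b(mod(R))` the shifted stalk complexes suffice (`sumThrough_stalk`). The
center is thus governed by `Extⁿ(M, M)` for modules `M`, which leaves the degrees 0 and 1. In degree
0, an element acts on `R` by some scalar, and this determines it everywhere because `R` is a
generator.

In degree 1, the component on `R` vanishes by projectivity. On `R/pˡ`, multiplication with `x`
factors through `R/pˡ⁻¹`, where by induction the component is a multiple of the Auslander–Reiten
class, and that class dies under maps to `R/pˡ`. So the component on `R/pˡ` is annihilated by `p`.
The classes annihilated by `p` are exactly the multiples of the Auslander–Reiten class, since this
class is a multiple of every nonzero class (`exists_comp_eq_extClass`), and the scalar matters only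
modulo `p`. Conversely, Auslander–Reiten classes vanish when composed with maps between cyclic
modules of different length, so the residues can be prescribed freely (`genClass_naturality`).
Products of two elements of degree 1 lie in degree 2, hence vanish; this gives the trivial
extension. -/

/-- `f` is a finite sum of morphisms which factor through objects of the family `S`. -/
def SumThrough {C : Type*} [Category* C] [Preadditive C] {ι : Type*} (S : ι → C) {X Y : C}
    (f : X ⟶ Y) : Prop :=
  ∃ (κ : Type) (_ : Fintype κ) (j : κ → ι) (a : ∀ k, X ⟶ S (j k)) (b : ∀ k, S (j k) ⟶ Y),
    f = ∑ k, a k ≫ b k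

variable {C : Type*} [Category* C] [Preadditive C] {ι : Type*} {S : ι → C}

namespace SumThrough

lemma of_comp {X Y : C} (i : ι) (a : X ⟶ S i) (b : S i ⟶ Y) : SumThrough S (a ≫ b) :=
  ⟨Unit, inferInstance, fun _ => i, fun _ => a, fun _ => b, by simp⟩

lemma zero (X Y : C) : SumThrough S (0 : X ⟶ Y) :=
  ⟨Empty, inferInstance, Empty.elim, fun k => k.elim, fun k => k.elim, by simp⟩

lemma add {X Y : C} {f g : X ⟶ Y} (hf : SumThrough S f) (hg : SumThrough S g) :
    SumThrough S (f + g) := by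
  obtain ⟨κ, _, j, a, b, rfl⟩ := hf
  obtain ⟨κ', _, j', a', b', rfl⟩ := hg
  exact ⟨κ ⊕ κ', inferInstance, Sum.elim j j', fun k => Sum.rec a a' k,
    fun k => Sum.rec b b' k, by simp⟩

lemma sum {κ : Type*} (s : Finset κ) {X Y : C} {f : κ → (X ⟶ Y)}
    (hf : ∀ k ∈ s, SumThrough S (f k)) : SumThrough S (∑ k ∈ s, f k) :=
  Finset.sum_induction f (SumThrough S) (fun _ _ => add) (zero X Y) hf

lemma comp_left {X Y Z : C} (g : X ⟶ Y) {f : Y ⟶ Z} (hf : SumThrough S f) :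
    SumThrough S (g ≫ f) := by
  obtain ⟨κ, _, j, a, b, rfl⟩ := hf
  exact ⟨κ, inferInstance, j, fun k => g ≫ a k, b, by simp [Preadditive.comp_sum]⟩

lemma comp_right {X Y Z : C} {f : X ⟶ Y} (hf : SumThrough S f) (g : Y ⟶ Z) :
    SumThrough S (f ≫ g) := by
  obtain ⟨κ, _, j, a, b, rfl⟩ := hf
  exact ⟨κ, inferInstance, j, a, fun k => b k ≫ g, by simp [Preadditive.sum_comp]⟩

lemma comp_id_comp {X Y Z : C} (f : X ⟶ Y) (g : Y ⟶ Z) (hY : SumThrough S (𝟙 Y)) :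
    SumThrough S (f ≫ g) := by
  simpa using (hY.comp_left f).comp_right g

lemma trans {κ : Type*} {T : κ → C} {X Y : C} {f : X ⟶ Y} (hf : SumThrough T f)
    (hT : ∀ k, SumThrough S (𝟙 (T k))) : SumThrough S f := by
  obtain ⟨κ, _, j, a, b, rfl⟩ := hf
  exact sum _ fun k _ => comp_id_comp _ _ (hT _)

lemma id_of_iso {X Y : C} (e : X ≅ Y) (hX : SumThrough S (𝟙 X)) : SumThrough S (𝟙 Y) := by
  simpa using comp_id_comp e.inv e.hom hX

variable {D : Type*} [Category* D] [Preadditive D] {F G : C ⥤ D} [F.Additive]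

/-- Naturality moves `τ` past the second factor of each summand `a ≫ b` of the identity, so that
only components at the objects `S i` remain. -/
lemma app_eq_zero {τ : F ⟶ G} {X : C} (hX : SumThrough S (𝟙 X)) (hτ : ∀ i, τ.app (S i) = 0) :
    τ.app X = 0 := by
  obtain ⟨κ, _, j, a, b, h⟩ := hX
  rw [← Category.id_comp (τ.app X), ← F.map_id, h, Functor.map_sum, Preadditive.sum_comp]
  exact Finset.sum_eq_zero fun k _ => by
    rw [F.map_comp, Category.assoc, τ.naturality, hτ, Limits.zero_comp, Limits.comp_zero]

lemma app_eq {τ τ' : F ⟶ G} {X : C} (hX : SumThrough S (𝟙 X))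
    (h : ∀ i, τ.app (S i) = τ'.app (S i)) : τ.app X = τ'.app X := by
  rw [← sub_eq_zero, ← NatTrans.app_sub]
  exact app_eq_zero hX fun i => by rw [NatTrans.app_sub, h, sub_self]

end SumThrough

variable {D : Type*} [Category* D] [Preadditive D] {F G : C ⥤ D} [F.Additive] [G.Additive]

/-- A family of morphisms on objects `S i` which is natural with respect to all morphisms between
these objects extends to a natural transformation if the identity of each object is a sum of
morphisms which factor through objects `S i`. -/
lemma exists_natTrans_extending (hS : ∀ X, SumThrough S (𝟙 X)) (η : ∀ i, F.obj (S i) ⟶ G.obj (S i))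
    (hη : ∀ (i j : ι) (f : S i ⟶ S j), F.map f ≫ η j = η i ≫ G.map f) :
    ∃ τ : F ⟶ G, ∀ i, τ.app (S i) = η i := by
  choose κ hκ j a b h using hS
  -- Naturality forces this formula; `key` makes it independent of the chosen decomposition.
  let t (X : C) : F.obj X ⟶ G.obj X := ∑ k, F.map (a X k) ≫ η (j X k) ≫ G.map (b X k)
  have key {X : C} (i : ι) (f : X ⟶ S i) : t X ≫ G.map f = F.map f ≫ η i := by
    calc t X ≫ G.map f = ∑ k, F.map (a X k) ≫ η (j X k) ≫ G.map (b X k ≫ f) := by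
          simp [t, Preadditive.sum_comp]
      _ = ∑ k, F.map (a X k ≫ b X k) ≫ F.map f ≫ η i := by
          refine Finset.sum_congr rfl fun k _ => ?_
          rw [← hη, F.map_comp, F.map_comp, Category.assoc, Category.assoc]
      _ = F.map f ≫ η i := by
          rw [← Preadditive.sum_comp, ← Functor.map_sum, ← h, F.map_id, Category.id_comp]
  refine ⟨{ app := t, naturality := fun X Y f => ?_ }, fun i => ?_⟩
  · calc F.map f ≫ t Y = ∑ k, (F.map (f ≫ a Y k) ≫ η (j Y k)) ≫ G.map (b Y k) := by
          simp [t, Preadditive.comp_sum]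
      _ = ∑ k, t X ≫ G.map f ≫ G.map (a Y k ≫ b Y k) := by
          refine Finset.sum_congr rfl fun k _ => ?_
          rw [← key]; simp
      _ = t X ≫ G.map f := by
          rw [← Preadditive.comp_sum, ← Preadditive.comp_sum, ← Functor.map_sum, ← h, G.map_id,
            Category.comp_id]
  · simpa using key i (𝟙 (S i))

end SumThrough

/-! ### Powers of a prime and an element of valuation one -/

section Arithmetic

variable {R : Type u} [CommRing R] [IsDedekindDomain R] (p : HeightOneSpectrum R) {x : R}

lemma pow_asIdeal_le_asIdeal {n : ℕ} (hn : n ≠ 0) : p.asIdeal ^ n ≤ p.asIdeal :=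
  Ideal.pow_le_self hn

lemma mem_pow_of_mul_mem_pow {n : ℕ} {c a : R} (hc : c ∉ p.asIdeal) (h : c * a ∈ p.asIdeal ^ n) :
    a ∈ p.asIdeal ^ n :=
  (p.isPrime.mul_mem_pow p.asIdeal h).resolve_left hc

/-- The `p`-adic valuation of `x` is at most one, so dividing by `x` loses at most one power of `p`.
-/
lemma mem_pow_of_mul_mem_pow_succ (hx' : x ∉ p.asIdeal ^ 2) {n : ℕ} {a : R}
    (h : x * a ∈ p.asIdeal ^ (n + 1)) : a ∈ p.asIdeal ^ n := by
  rw [← p.intValuation_le_pow_iff_mem] at hx' h ⊢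
  rw [map_mul] at h
  by_cases ha : a = 0
  · simp [ha]
  have hx0 : x ≠ 0 := by rintro rfl; simp at hx'
  rw [p.intValuation_if_neg ha] at h ⊢
  rw [p.intValuation_if_neg hx0, ← WithZero.exp_add] at h
  rw [p.intValuation_if_neg hx0] at hx'
  rw [WithZero.exp_le_exp] at *
  push_cast at *
  omega

/-- Locally at `p` the element `x` generates `p`, so up to any power of `p` an element of `pⁿ⁺¹` is
`x` times one of `pⁿ`. With `n = 0` this trades elements of `p` for multiples of `x`. -/
lemma exists_sub_mul_mem_pow (hx : x ∈ p.asIdeal) (hx' : x ∉ p.asIdeal ^ 2) (m : ℕ) {n : ℕ} {a : R}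
    (ha : a ∈ p.asIdeal ^ (n + 1)) : ∃ d ∈ p.asIdeal ^ n, a - x * d ∈ p.asIdeal ^ m := by
  suffices H : ∀ (k n : ℕ) (a : R), a ∈ p.asIdeal ^ (n + 1) →
      ∃ d ∈ p.asIdeal ^ n, a - x * d ∈ p.asIdeal ^ (n + 1 + k) by
    obtain ⟨d, hd, h⟩ := H m n a ha
    exact ⟨d, hd, Ideal.pow_le_pow_right (by omega) h⟩
  intro k
  induction k with
  | zero => exact fun n a ha => ⟨0, zero_mem _, by simpa using ha⟩
  | succ k ih =>
    intro n a ha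
    have hpow (j : ℕ) : x ^ j ∉ p.asIdeal ^ (j + 1) := by
      induction j with
      | zero => simpa using p.isPrime.one_notMem
      | succ j ih => exact fun h => ih (mem_pow_of_mul_mem_pow_succ p hx' (by rwa [← pow_succ']))
    -- Successive approximation: `xⁿ⁺¹` generates `pⁿ⁺¹` modulo `pⁿ⁺²`, and the error `e` is one
    -- step deeper.
    obtain ⟨d, e, he, rfl⟩ := Ideal.exists_mul_add_mem_pow_succ p.ne_bot _ a
      (Ideal.pow_mem_pow hx (n + 1)) (hpow (n + 1)) ha
    obtain ⟨d', hd', h⟩ := ih (n + 1) e he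
    refine ⟨x ^ n * d + d', add_mem (Ideal.mul_mem_right _ _ (Ideal.pow_mem_pow hx n))
      (Ideal.pow_le_pow_right (by omega) hd'), ?_⟩
    convert h using 1
    · ring
    · ring

lemma exists_mul_sub_one_mem_pow {c : R} (hc : c ∉ p.asIdeal) (n : ℕ) :
    ∃ d, d * c - 1 ∈ p.asIdeal ^ n := by
  obtain ⟨y, hy⟩ := Ideal.Quotient.isUnit_mk_pow_of_notMem p.asIdeal hc (n := n) |>.exists_left_inv
  obtain ⟨d, rfl⟩ := Ideal.Quotient.mk_surjective y
  exact ⟨d, by rw [← Ideal.Quotient.eq_zero_iff_mem]; simp [hy]⟩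

lemma le_of_pow_le {m n : ℕ} (h : p.asIdeal ^ m ≤ p.asIdeal ^ n) : n ≤ m :=
  (Ideal.pow_right_strictAnti p.asIdeal p.ne_bot p.isPrime.ne_top).le_iff_ge.1 h

end Arithmetic

/-! ### Homomorphisms between cyclic modules -/

section Cyclic

variable {R : Type u} [CommRing R]

/-- Multiplication with `c`, as a map between cyclic modules. -/
def quotMul {I J : Ideal R} (c : R) (h : ∀ a ∈ I, c * a ∈ J) : (R ⧸ I) →ₗ[R] (R ⧸ J) :=
  Submodule.mapQ I J (LinearMap.lsmul R R c) h

lemma quotMul_mk {I J : Ideal R} (c : R) (h : ∀ a ∈ I, c * a ∈ J) (a : R) :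
    quotMul c h (Ideal.Quotient.mk I a) = Ideal.Quotient.mk J (c * a) := rfl

lemma exists_eq_quotMul {I J : Ideal R} (f : (R ⧸ I) →ₗ[R] (R ⧸ J)) :
    ∃ (c : R) (h : ∀ a ∈ I, c * a ∈ J), f = quotMul c h := by
  obtain ⟨c, hc⟩ := Ideal.Quotient.mk_surjective (f (Ideal.Quotient.mk I 1))
  have hf (a : R) : f (Ideal.Quotient.mk I a) = Ideal.Quotient.mk J (c * a) := by
    have : Ideal.Quotient.mk I a = a • Ideal.Quotient.mk I 1 := by
      rw [← Ideal.Quotient.mkₐ_eq_mk R, ← map_smul, smul_eq_mul, mul_one]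
    rw [this, f.map_smul, ← hc, mul_comm]
    rfl
  refine ⟨c, fun a ha => ?_, ?_⟩
  · rw [← Ideal.Quotient.eq_zero_iff_mem, ← hf, Ideal.Quotient.eq_zero_iff_mem.2 ha, map_zero]
  · ext
    exact hf 1

end Cyclic

/-! ### The candidate Auslander–Reiten sequences as sequences of modules -/

section Tube

/-- The first map of `tubeSeq`. -/
abbrev tubeIn {R : Type u} [CommRing R] (p : Ideal R) {x : R} (hx : x ∈ p) (l : ℕ) :
    cyc p l →ₗ[R] cyc p (l - 1) × cyc p (l + 1) :=
  (cycProj p (Nat.sub_le l 1)).prod (cycMul p hx le_rfl)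

/-- The second map of `tubeSeq`. -/
abbrev tubeOut {R : Type u} [CommRing R] (p : Ideal R) {x : R} (hx : x ∈ p) (l : ℕ) :
    cyc p (l - 1) × cyc p (l + 1) →ₗ[R] cyc p l :=
  (cycProj p (Nat.le_succ l)).comp (LinearMap.snd R _ _) -
    (cycMul p hx (by omega)).comp (LinearMap.fst R _ _)

variable {R : Type u} [CommRing R] [IsDedekindDomain R] (p : HeightOneSpectrum R) {x : R}

lemma quotMul_bijective {l : ℕ} {c : R} (hc : c ∉ p.asIdeal)
    (h : ∀ a ∈ p.asIdeal ^ l, c * a ∈ p.asIdeal ^ l) : Function.Bijective (quotMul c h) := by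
  obtain ⟨d, hd⟩ := exists_mul_sub_one_mem_pow p hc l
  have key (a : R) : Ideal.Quotient.mk (p.asIdeal ^ l) (d * (c * a)) = Ideal.Quotient.mk _ a := by
    rw [Ideal.Quotient.mk_eq_mk_iff_sub_mem]
    convert Ideal.mul_mem_right a _ hd using 1
    ring
  refine Function.bijective_iff_has_inverse.2
    ⟨quotMul (I := p.asIdeal ^ l) (J := p.asIdeal ^ l) d fun a ha => Ideal.mul_mem_left _ _ ha,
      fun y => ?_, fun y => ?_⟩
  · obtain ⟨a, rfl⟩ := Ideal.Quotient.mk_surjective y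
    exact key a
  · obtain ⟨a, rfl⟩ := Ideal.Quotient.mk_surjective y
    rw [quotMul_mk, quotMul_mk, mul_left_comm]
    exact key a

/-- The map is multiplication with some `c`. If `c ∈ p`, then `c` is `x d` modulo `pˡ` and the map
passes through `R/pˡ⁻¹`. If `c ∉ p`, being well defined forces `l ≤ m`: the map is bijective for `m
= l` and lifts to `R/pˡ⁺¹` for `m > l`. -/
lemma cyc_lift_or_bijective (hx : x ∈ p.asIdeal) (hx' : x ∉ p.asIdeal ^ 2) {m l : ℕ} (hl : l ≠ 0)
    (f : cyc p.asIdeal m →ₗ[R] cyc p.asIdeal l) :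
    (m = l ∧ Function.Bijective f) ∨
      ∃ f' : cyc p.asIdeal m →ₗ[R] cyc p.asIdeal (l - 1) × cyc p.asIdeal (l + 1),
        (tubeOut p.asIdeal hx l).comp f' = f := by
  obtain ⟨l, rfl⟩ := Nat.exists_eq_succ_of_ne_zero hl
  obtain ⟨c, h, rfl⟩ := exists_eq_quotMul f
  by_cases hc : c ∈ p.asIdeal
  · right
    obtain ⟨d, -, hd⟩ := exists_sub_mul_mem_pow p hx hx' (l + 1) (n := 0) (by simpa using hc)
    -- The sign of `-d` cancels the one in `(b, c) ↦ c - x b`.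
    refine ⟨LinearMap.prod (quotMul (-d) fun a ha => mem_pow_of_mul_mem_pow_succ p hx' ?_) 0, ?_⟩
    · have := sub_mem (Ideal.mul_mem_right a _ hd) (h a ha)
      refine (congr_arg (· ∈ p.asIdeal ^ (l + 1)) ?_).mp this
      ring
    · ext
      change Ideal.Quotient.mk _ 0 - Ideal.Quotient.mk _ (x * (-d * 1)) = Ideal.Quotient.mk _ (c * 1)
      rw [← map_sub, eq_comm, Ideal.Quotient.mk_eq_mk_iff_sub_mem]
      convert hd using 1
      ring
  · have hle : l + 1 ≤ m := le_of_pow_le p fun a ha => mem_pow_of_mul_mem_pow p hc (h a ha)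
    rcases hle.eq_or_lt with rfl | hlt
    · exact Or.inl ⟨rfl, quotMul_bijective p hc _⟩
    · right
      refine ⟨LinearMap.prod 0 (quotMul c fun a ha =>
        Ideal.mul_mem_left _ _ (Ideal.pow_le_pow_right hlt ha)), ?_⟩
      ext
      change Ideal.Quotient.mk _ (c * 1) - Ideal.Quotient.mk _ (x * 0) = Ideal.Quotient.mk _ (c * 1)
      simp

/-- Dual to `cyc_lift_or_bijective`: for `c ∈ p` the map extends to `R/pˡ⁺¹` by `d` with `c` equal
to `x d` modulo `pᵐ`, and for `c ∉ p` and `m < l` it factors through `R/pˡ⁻¹`. -/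
lemma cyc_desc_or_bijective (hx : x ∈ p.asIdeal) (hx' : x ∉ p.asIdeal ^ 2) {m l : ℕ} (hl : l ≠ 0)
    (f : cyc p.asIdeal l →ₗ[R] cyc p.asIdeal m) :
    (m = l ∧ Function.Bijective f) ∨
      ∃ f' : cyc p.asIdeal (l - 1) × cyc p.asIdeal (l + 1) →ₗ[R] cyc p.asIdeal m,
        f'.comp (tubeIn p.asIdeal hx l) = f := by
  obtain ⟨l, rfl⟩ := Nat.exists_eq_succ_of_ne_zero hl
  obtain ⟨c, h, rfl⟩ := exists_eq_quotMul f
  by_cases hc : c ∈ p.asIdeal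
  · right
    obtain ⟨d, -, hd⟩ := exists_sub_mul_mem_pow p hx hx' m (n := 0) (by simpa using hc)
    refine ⟨(quotMul d fun a ha => ?_).comp (LinearMap.snd R _ _), ?_⟩
    -- Multiplication with `d` is well defined: modulo `pᵐ`, `d a` equals `d x b`, hence `c b`,
    -- which is zero because `c` is well defined.
    · obtain ⟨b, hb, hab⟩ := exists_sub_mul_mem_pow p hx hx' m ha
      have h₁ := Ideal.mul_mem_right b _ hd
      have h₂ := h b hb
      have h₃ := Ideal.mul_mem_left _ d hab
      convert add_mem (sub_mem h₂ h₁) h₃ using 1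
      ring
    · ext
      change Ideal.Quotient.mk _ (d * (x * 1)) = Ideal.Quotient.mk _ (c * 1)
      rw [eq_comm, Ideal.Quotient.mk_eq_mk_iff_sub_mem]
      convert hd using 1
      ring
  · have hle : m ≤ l + 1 := le_of_pow_le p fun a ha => mem_pow_of_mul_mem_pow p hc (h a ha)
    rcases hle.eq_or_lt with rfl | hlt
    · exact Or.inl ⟨rfl, quotMul_bijective p hc _⟩
    · right
      refine ⟨(quotMul c fun a ha => Ideal.mul_mem_left _ _
        (Ideal.pow_le_pow_right (Nat.lt_succ_iff.1 hlt) ha)).comp (LinearMap.fst R _ _), ?_⟩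
      ext
      rfl

lemma tube_injective (hx : x ∈ p.asIdeal) (hx' : x ∉ p.asIdeal ^ 2) (l : ℕ) :
    Function.Injective
      (tubeIn p.asIdeal hx l) := by
  rw [injective_iff_map_eq_zero]
  intro y hy
  obtain ⟨a, rfl⟩ := Ideal.Quotient.mk_surjective y
  have h : Ideal.Quotient.mk (p.asIdeal ^ (l + 1)) (x * a) = 0 := congr_arg Prod.snd hy
  rw [Ideal.Quotient.eq_zero_iff_mem] at h ⊢
  exact mem_pow_of_mul_mem_pow_succ p hx' h

lemma tube_surjective (hx : x ∈ p.asIdeal) (l : ℕ) :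
    Function.Surjective (tubeOut p.asIdeal hx l) := by
  intro y
  obtain ⟨a, rfl⟩ := Ideal.Quotient.mk_surjective y
  refine ⟨(0, Ideal.Quotient.mk _ a), ?_⟩
  change Ideal.Quotient.mk _ a - Ideal.Quotient.mk _ (x * 0) = Ideal.Quotient.mk _ a
  simp

lemma tube_exact (hx : x ∈ p.asIdeal) (hx' : x ∉ p.asIdeal ^ 2) {l : ℕ} (hl : l ≠ 0) :
    Function.Exact
      (tubeIn p.asIdeal hx l)
      (tubeOut p.asIdeal hx l) := by
  obtain ⟨l, rfl⟩ := Nat.exists_eq_succ_of_ne_zero hl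
  rintro ⟨b, c⟩
  obtain ⟨b, rfl⟩ := Ideal.Quotient.mk_surjective b
  obtain ⟨c, rfl⟩ := Ideal.Quotient.mk_surjective c
  constructor
  · intro h
    replace h : Ideal.Quotient.mk (p.asIdeal ^ (l + 1)) c -
      Ideal.Quotient.mk (p.asIdeal ^ (l + 1)) (x * b) = 0 := h
    rw [← map_sub, Ideal.Quotient.eq_zero_iff_mem] at h
    -- The preimage is `b + d`: the correction `d` vanishes in the first summand and repairs the
    -- second.
    obtain ⟨d, hd, h⟩ := exists_sub_mul_mem_pow p hx hx' (l + 1 + 1) h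
    refine ⟨Ideal.Quotient.mk _ (b + d), ?_⟩
    refine Prod.ext ?_ ?_
    · change Ideal.Quotient.mk _ (b + d) = Ideal.Quotient.mk _ b
      rw [Ideal.Quotient.mk_eq_mk_iff_sub_mem]
      simpa using hd
    · change Ideal.Quotient.mk _ (x * (b + d)) = Ideal.Quotient.mk _ c
      rw [eq_comm, Ideal.Quotient.mk_eq_mk_iff_sub_mem]
      convert h using 1
      ring
  · rintro ⟨y, hy⟩
    obtain ⟨a, rfl⟩ := Ideal.Quotient.mk_surjective y
    rw [← hy]
    exact sub_self (Ideal.Quotient.mk _ (x * a))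

/-- A map `R/pˡ ⟶ R/pˡ⁺¹` is multiplication with an element of `p`. So any composite `R/pˡ ⟶ R/pˡ`
through the middle term is too, and cannot be the identity. -/
lemma tube_not_split (hx : x ∈ p.asIdeal) {l : ℕ} (hl : l ≠ 0)
    (s : cyc p.asIdeal l →ₗ[R] cyc p.asIdeal (l - 1) × cyc p.asIdeal (l + 1)) :
    (tubeOut p.asIdeal hx l).comp s ≠ LinearMap.id := by
  intro h
  obtain ⟨b, _, hb⟩ := exists_eq_quotMul ((LinearMap.fst R _ _).comp s)
  obtain ⟨c, hc, hc'⟩ := exists_eq_quotMul ((LinearMap.snd R _ _).comp s)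
  replace hb : (s (Ideal.Quotient.mk _ 1)).1 = Ideal.Quotient.mk _ (b * 1) :=
    LinearMap.congr_fun hb (Ideal.Quotient.mk _ 1)
  replace hc' : (s (Ideal.Quotient.mk _ 1)).2 = Ideal.Quotient.mk _ (c * 1) :=
    LinearMap.congr_fun hc' (Ideal.Quotient.mk _ 1)
  have h₁ : cycProj p.asIdeal (Nat.le_succ l) (s (Ideal.Quotient.mk _ 1)).2 -
      cycMul p.asIdeal hx (by omega) (s (Ideal.Quotient.mk _ 1)).1 = Ideal.Quotient.mk _ 1 :=
    LinearMap.congr_fun h (Ideal.Quotient.mk _ 1)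
  rw [hb, hc'] at h₁
  replace h₁ : Ideal.Quotient.mk (p.asIdeal ^ l) (c * 1) -
    Ideal.Quotient.mk (p.asIdeal ^ l) (x * (b * 1)) = Ideal.Quotient.mk _ 1 := h₁
  rw [← map_sub, Ideal.Quotient.mk_eq_mk_iff_sub_mem] at h₁
  have hcp : c ∈ p.asIdeal := by
    by_contra hcp
    have := le_of_pow_le p fun a ha => mem_pow_of_mul_mem_pow p hcp (hc a ha)
    omega
  refine p.isPrime.one_notMem ?_
  refine (congr_arg (· ∈ p.asIdeal) ?_).mp
    (sub_mem (sub_mem hcp (Ideal.mul_mem_right b _ hx)) (pow_asIdeal_le_asIdeal p hl h₁))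
  ring

end Tube

/-! ### Generating `mod(R)` by `R` and the modules `R/pˡ` -/

section Generation

variable {R : Type u} [CommRing R] [IsDedekindDomain R]

/-- The module `R` and the modules `R/pˡ`. -/
def gen (R : Type u) [CommRing R] [IsDedekindDomain R] :
    Option (HeightOneSpectrum R × ℕ+) → FGModuleCat.{u} R
  | none => FGModuleCat.of R R
  | some i => FGModuleCat.of R (cyc i.1.asIdeal i.2)

variable {M : Type u} [AddCommGroup M] [Module R M] [Module.Finite R M]

lemma sumThrough_ofHom_comp_self {N : Type u} [AddCommGroup N] [Module R N] [Module.Finite R N]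
    (a : M →ₗ[R] R) (b : R →ₗ[R] N) :
    SumThrough (gen R) (FGModuleCat.ofHom (b ∘ₗ a)) :=
  SumThrough.of_comp (S := gen R) none (FGModuleCat.ofHom a) (FGModuleCat.ofHom b)

/-- The exponent `0`, which the structure theorem over a local ring does not exclude, gives the zero
module and hence the zero map. -/
lemma sumThrough_ofHom_comp_cyc {N : Type u} [AddCommGroup N] [Module R N] [Module.Finite R N]
    (p : HeightOneSpectrum R) (l : ℕ) (a : M →ₗ[R] cyc p.asIdeal l) (b : cyc p.asIdeal l →ₗ[R] N) :
    SumThrough (gen R) (FGModuleCat.ofHom (b ∘ₗ a)) := by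
  rcases Nat.eq_zero_or_pos l with rfl | hl
  · have : Subsingleton (cyc p.asIdeal 0) := by
      rw [Submodule.Quotient.subsingleton_iff, pow_zero, Ideal.one_eq_top]
    have : b ∘ₗ a = 0 := by
      ext m
      simp [Subsingleton.elim (a m) 0]
    rw [this]
    exact SumThrough.zero _ _
  · exact SumThrough.of_comp (S := gen R) (some (p, ⟨l, hl⟩)) (FGModuleCat.ofHom a)
      (FGModuleCat.ofHom b)

/-- The ideal of all `r` such that multiplication with `r` on `M` is a sum of morphisms through
the objects `gen R i`. -/
def sumThroughIdeal (R M : Type u) [CommRing R] [IsDedekindDomain R] [AddCommGroup M] [Module R M]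
    [Module.Finite R M] : Ideal R where
  carrier := {r | SumThrough (gen R) (FGModuleCat.ofHom (r • LinearMap.id : M →ₗ[R] M))}
  zero_mem' := by
    change SumThrough _ _
    rw [zero_smul]
    exact SumThrough.zero _ _
  add_mem' {r s} hr hs := by
    change SumThrough _ _
    rw [add_smul]
    exact SumThrough.add hr hs
  smul_mem' r s hs := by
    change SumThrough _ _
    have : (((r • s) • LinearMap.id : M →ₗ[R] M)) =
        (r • LinearMap.id : M →ₗ[R] M) ∘ₗ (s • LinearMap.id) := by
      ext; simp [mul_smul]
    rw [this]
    exact SumThrough.comp_right hs (FGModuleCat.ofHom (r • LinearMap.id : M →ₗ[R] M))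

/-- The localisations of sums of morphisms through objects `gen R i`. -/
lemma exists_sumThrough_localized {S : Submonoid R} {M' : Type u} [AddCommGroup M'] [Module R M']
    (φ : M →ₗ[R] M') [IsLocalizedModule S φ] {κ : Type*} (t : Finset κ) (c : κ → (M →ₗ[R] M'))
    (hc : ∀ k ∈ t, ∃ (h : M →ₗ[R] M) (s : S), SumThrough (gen R) (FGModuleCat.ofHom h) ∧
      φ ∘ₗ h = s • c k) :
    ∃ (h : M →ₗ[R] M) (s : S), SumThrough (gen R) (FGModuleCat.ofHom h) ∧
      φ ∘ₗ h = s • ∑ k ∈ t, c k := by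
  classical
  induction t using Finset.induction_on with
  | empty => exact ⟨0, 1, SumThrough.zero _ _, by simp⟩
  | insert k t hk ih =>
    obtain ⟨h, s, hh, hs⟩ := hc k (Finset.mem_insert_self _ _)
    obtain ⟨h', s', hh', hs'⟩ := ih fun j hj => hc j (Finset.mem_insert_of_mem hj)
    refine ⟨(s' : R) • h + (s : R) • h', s' * s, ?_, ?_⟩
    · exact SumThrough.add
        (SumThrough.comp_right hh (FGModuleCat.ofHom ((s' : R) • LinearMap.id : M →ₗ[R] M)))
        (SumThrough.comp_right hh' (FGModuleCat.ofHom ((s : R) • LinearMap.id : M →ₗ[R] M)))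
    · rw [Finset.sum_insert hk, LinearMap.comp_add, LinearMap.comp_smul, LinearMap.comp_smul, hs,
        hs', smul_add, mul_smul, mul_comm, mul_smul]
      rfl

/-- As `M` is finite, an identity of maps that holds after localisation holds after multiplication
with one element of `S`. -/
lemma mem_sumThroughIdeal_of_localized {S : Submonoid R} {M' : Type u} [AddCommGroup M']
    [Module R M'] (φ : M →ₗ[R] M') [IsLocalizedModule S φ]
    (H : ∃ (h : M →ₗ[R] M) (s : S), SumThrough (gen R) (FGModuleCat.ofHom h) ∧ φ ∘ₗ h = s • φ) :
    ∃ s ∈ S, s ∈ sumThroughIdeal R M := by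
  obtain ⟨h, s, hh, hs⟩ := H
  obtain ⟨t, ht⟩ := Module.Finite.exists_smul_of_comp_eq_of_isLocalizedModule S φ h
    (s • LinearMap.id) (by rw [hs]; ext m; exact (φ.map_smul_of_tower s m).symm)
  refine ⟨t * s, (t * s).2, ?_⟩
  change SumThrough _ _
  rw [mul_smul]
  have ht' : (t : R) • (s : R) • (LinearMap.id : M →ₗ[R] M) = (t : R) • h := ht.symm
  rw [ht']
  exact SumThrough.comp_right hh (FGModuleCat.ofHom ((t : R) • LinearMap.id : M →ₗ[R] M))

/-- Over the principal ideal domain `R_P` the localised module is a finite sum of cyclic modules.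
The resulting decomposition of its identity comes from `R` up to denominators outside `P`. -/
lemma sumThroughIdeal_not_le (P : Ideal R) [P.IsMaximal] : ¬ sumThroughIdeal R M ≤ P := by
  intro hle
  let A := Localization.AtPrime P
  let M' := LocalizedModule P.primeCompl M
  let φ : M →ₗ[R] M' := LocalizedModule.mkLinearMap P.primeCompl M
  have : IsPrincipalIdealRing A := by
    refine IsPrincipalIdealRing.of_finite_maximals
      ((Set.finite_singleton (IsLocalRing.maximalIdeal A)).subset fun I hI => ?_)
    exact IsLocalRing.eq_maximalIdeal hI
  have : Module.Finite A M' := inferInstance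
  obtain ⟨n, ι, _, π, hπ, e, ⟨f⟩⟩ := Module.equiv_free_prod_directSum (R := A) (M := M')
  classical
  have hmax (i : ι) : IsLocalRing.maximalIdeal A = Ideal.span {π i} :=
    (IsLocalRing.eq_maximalIdeal (PrincipalIdealRing.isMaximal_of_irreducible (hπ i))).symm
  have hι (i : ι) : IsLocalRing.maximalIdeal A ^ e i = Ideal.span {π i ^ e i} := by
    rw [hmax, Ideal.span_singleton_pow]
  have lift {N N' : Type u} [AddCommGroup N] [Module R N] [Module.Finite R N] [AddCommGroup N']
      [Module R N'] (ψ : N →ₗ[R] N') (a : M →ₗ[R] N') (b : N' →ₗ[R] M')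
      (ha : ∃ (a' : M →ₗ[R] N) (s : P.primeCompl), ψ ∘ₗ a' = s • a)
      -- Clearing denominators: a local map through `N'` becomes a global one through `N`.
      (hN : ∀ (a' : M →ₗ[R] N) (b' : N →ₗ[R] M), SumThrough (gen R) (FGModuleCat.ofHom (b' ∘ₗ a'))) :
      ∃ (h : M →ₗ[R] M) (s : P.primeCompl), SumThrough (gen R) (FGModuleCat.ofHom h) ∧
        φ ∘ₗ h = s • (b ∘ₗ a) := by
    have : Module.FinitePresentation R N := Module.finitePresentation_of_finite R N
    obtain ⟨a', s, ha'⟩ := ha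
    obtain ⟨b', t, hb'⟩ :=
      Module.FinitePresentation.exists_lift_of_isLocalizedModule P.primeCompl φ (b ∘ₗ ψ)
    refine ⟨b' ∘ₗ a', t * s, hN a' b', ?_⟩
    ext m
    have h₁ := LinearMap.congr_fun ha' m
    have h₂ := LinearMap.congr_fun hb' (a' m)
    simp only [LinearMap.comp_apply, LinearMap.smul_apply] at h₁ h₂ ⊢
    rw [h₂, h₁, mul_smul, LinearMap.map_smul_of_tower]
  -- The projections onto the cyclic summands, restricted along `φ`; they add up to `φ`.
  let c : Fin n ⊕ ι → (M →ₗ[R] M') := Sum.elim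
    (fun k => ((f.symm.toLinearMap ∘ₗ LinearMap.inl A _ _ ∘ₗ
        Finsupp.lsingle k).restrictScalars R) ∘ₗ
      ((Finsupp.lapply k ∘ₗ LinearMap.fst A _ _ ∘ₗ f.toLinearMap).restrictScalars R ∘ₗ φ))
    (fun i => ((f.symm.toLinearMap ∘ₗ LinearMap.inr A _ _ ∘ₗ
        DirectSum.lof A ι (fun i => A ⧸ Ideal.span {π i ^ e i}) i).restrictScalars R) ∘ₗ
      ((DirectSum.component A ι (fun i => A ⧸ Ideal.span {π i ^ e i}) i ∘ₗ
        LinearMap.snd A _ _ ∘ₗ f.toLinearMap).restrictScalars R ∘ₗ φ))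
  have hc : ∑ k, c k = φ := by
    ext m
    apply f.injective
    rw [Fintype.sum_sum_type, LinearMap.add_apply, map_add, LinearMap.sum_apply,
      LinearMap.sum_apply, map_sum, map_sum]
    have h₁ (k : Fin n) : f (c (Sum.inl k) m) = (Finsupp.single k ((f (φ m)).1 k), 0) :=
      f.apply_symm_apply _
    have h₂ (i : ι) : f (c (Sum.inr i) m) = (0, DirectSum.lof A ι _ i ((f (φ m)).2 i)) :=
      f.apply_symm_apply _
    rw [Finset.sum_congr rfl fun k _ => h₁ k, Finset.sum_congr rfl fun i _ => h₂ i]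
    refine Prod.ext ?_ ?_
    · simp only [Prod.fst_add, Prod.fst_sum, Finset.sum_const_zero, add_zero]
      exact Finsupp.univ_sum_single _
    · simp only [Prod.snd_add, Prod.snd_sum, Finset.sum_const_zero, zero_add]
      exact DirectSum.sum_univ_of _
  obtain ⟨s, hs, hs'⟩ : ∃ s ∈ P.primeCompl, s ∈ sumThroughIdeal R M := by
    refine mem_sumThroughIdeal_of_localized φ ?_
    conv =>
      enter [1, h, 1, s, 2, 2]
      rw [← hc]
    refine exists_sumThrough_localized φ Finset.univ c fun k _ => ?_
    rcases k with k | i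
    · refine lift (Algebra.linearMap R A) _ _ ?_ fun a' b' => sumThrough_ofHom_comp_self a' b'
      have : Module.FinitePresentation R M := Module.finitePresentation_of_finite R M
      exact Module.FinitePresentation.exists_lift_of_isLocalizedModule P.primeCompl _ _
    -- A torsion summand requires an irreducible element, so here `P` is nonzero even though `R` may
    -- be a field.
    · have hP : P ≠ ⊥ := by
        rintro rfl
        refine (hπ i).ne_zero ?_
        rw [← Ideal.span_singleton_eq_bot, ← hmax, ← Localization.AtPrime.map_eq_maximalIdeal,
          Ideal.map_bot]
      let p : HeightOneSpectrum R := ⟨P, inferInstance, hP⟩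
      let ψ : (R ⧸ P ^ e i) ≃ₗ[R] (A ⧸ Ideal.span {π i ^ e i}) :=
        (IsLocalization.AtPrime.equivQuotMaximalIdealPow P A (e i)).toLinearEquiv.trans
          ((Submodule.quotEquivOfEq _ _ (hι i)).restrictScalars R)
      exact lift ψ.toLinearMap _ _ ⟨ψ.symm.toLinearMap ∘ₗ _, 1, by
          rw [one_smul, ← LinearMap.comp_assoc, LinearEquiv.comp_symm, LinearMap.id_comp]⟩
        fun a' b' => sumThrough_ofHom_comp_cyc p (e i) a' b'
  exact hs (hle hs')

/-- The ideal of good scalars lies in no maximal ideal, so it contains 1. This replaces the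
structure theorem over `R`: a projective summand need not be free, but its identity is still a sum
of maps through `R`. -/
lemma sumThrough_gen (M : FGModuleCat.{u} R) : SumThrough (gen R) (𝟙 M) := by
  have : sumThroughIdeal R M = ⊤ := by
    by_contra h
    obtain ⟨P, hP, hle⟩ := Ideal.exists_le_maximal _ h
    exact sumThroughIdeal_not_le P hle
  have h1 : (1 : R) ∈ sumThroughIdeal R M := this ▸ Submodule.mem_top
  change SumThrough _ _ at h1
  rw [one_smul] at h1
  exact h1

end Generation

/-! ### Exactness in `mod(R)` in terms of elements -/

section ShortExact

variable {R : Type u} [CommRing R] [IsNoetherianRing R]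

lemma fg_mono {X Y : FGModuleCat.{u} R} {f : X ⟶ Y} (hf : Function.Injective f.hom.hom) : Mono f :=
  (forget₂ (FGModuleCat.{u} R) (ModuleCat.{u} R)).mono_of_mono_map
    ((ModuleCat.mono_iff_injective _).2 hf)

lemma fg_epi {X Y : FGModuleCat.{u} R} {f : X ⟶ Y} (hf : Function.Surjective f.hom.hom) : Epi f :=
  (forget₂ (FGModuleCat.{u} R) (ModuleCat.{u} R)).epi_of_epi_map
    ((ModuleCat.epi_iff_surjective _).2 hf)

lemma surjective_of_fg_epi {X Y : FGModuleCat.{u} R} (f : X ⟶ Y) [Epi f] :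
    Function.Surjective f.hom.hom :=
  (ModuleCat.epi_iff_surjective ((forget₂ (FGModuleCat.{u} R) (ModuleCat.{u} R)).map f)).1
    inferInstance

lemma fg_shortExact {S : ShortComplex (FGModuleCat.{u} R)} (hf : Function.Injective S.f.hom.hom)
    (h : Function.Exact S.f.hom.hom S.g.hom.hom) (hg : Function.Surjective S.g.hom.hom) :
    S.ShortExact where
  exact := by
    rw [← S.exact_map_iff_of_faithful (forget₂ (FGModuleCat.{u} R) (ModuleCat.{u} R)),
      ShortComplex.ShortExact.moduleCat_exact_iff_function_exact]
    exact h
  mono_f := fg_mono hf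
  epi_g := fg_epi hg

lemma fg_isIso {X Y : FGModuleCat.{u} R} {f : X ⟶ Y} (hf : Function.Bijective f.hom.hom) :
    IsIso f := by
  have := fg_mono hf.1
  have := fg_epi hf.2
  exact isIso_of_mono_of_epi f

end ShortExact

/-! ### The Auslander–Reiten property -/

section AlmostSplit

variable {R : Type u} [CommRing R]

lemma hom_eq_zero_of_sup_eq_top {I J : Ideal R} (hIJ : I ⊔ J = ⊤) {N : Type*} [AddCommGroup N]
    [Module R N] (f : (R ⧸ I) →ₗ[R] N) (hf : ∀ a ∈ J, a • f (Ideal.Quotient.mk I 1) = 0) :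
    f = 0 := by
  obtain ⟨a, ha, b, hb, hab⟩ := Submodule.mem_sup.1 (hIJ ▸ Submodule.mem_top : (1 : R) ∈ I ⊔ J)
  ext
  change f (Ideal.Quotient.mk I 1) = 0
  have : Ideal.Quotient.mk I 1 = b • Ideal.Quotient.mk I 1 := by
    rw [← Ideal.Quotient.mkₐ_eq_mk R, ← map_smul, smul_eq_mul, mul_one, Ideal.Quotient.mkₐ_eq_mk,
      Ideal.Quotient.mk_eq_mk_iff_sub_mem]
    simpa [← hab] using ha
  rw [this, map_smul, hf b hb]

variable [IsDedekindDomain R]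

lemma pow_sup_pow_eq_top {p q : HeightOneSpectrum R} (h : p ≠ q) (m n : ℕ) :
    p.asIdeal ^ m ⊔ q.asIdeal ^ n = ⊤ := by
  have : p.asIdeal.IsMaximal := p.isMaximal
  have : q.asIdeal.IsMaximal := q.isMaximal
  rw [← Ideal.isCoprime_iff_sup_eq]
  exact (Ideal.isCoprime_iff_sup_eq.2
    (Ideal.IsMaximal.coprime_of_ne ‹_› ‹_› fun h' => h (HeightOneSpectrum.ext h'))).pow

lemma cyc_hom_eq_zero {p q : HeightOneSpectrum R} (h : p ≠ q) {m n : ℕ}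
    (f : cyc p.asIdeal m →ₗ[R] cyc q.asIdeal n) : f = 0 := by
  refine hom_eq_zero_of_sup_eq_top (pow_sup_pow_eq_top h m n) f fun a ha => ?_
  obtain ⟨b, hb⟩ := Ideal.Quotient.mk_surjective (f (Ideal.Quotient.mk _ 1))
  rw [← hb]
  exact Ideal.Quotient.eq_zero_iff_mem.2 (Ideal.mul_mem_right _ _ ha)

lemma cyc_hom_self_eq_zero (p : HeightOneSpectrum R) {m : ℕ} (f : cyc p.asIdeal m →ₗ[R] R) :
    f = 0 := by
  obtain ⟨a, ha, ha0⟩ := Submodule.exists_mem_ne_zero_of_ne_bot (pow_ne_zero m p.ne_bot)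
  ext
  have : a • f (Ideal.Quotient.mk _ 1) = 0 := by
    rw [← map_smul, ← Ideal.Quotient.mkₐ_eq_mk R, ← map_smul, smul_eq_mul, mul_one,
      Ideal.Quotient.mkₐ_eq_mk, Ideal.Quotient.eq_zero_iff_mem.2 ha, map_zero]
  exact (smul_eq_zero.1 this).resolve_left ha0

/-- Reduces lifting for torsion modules to maps between cyclic modules: the image of the generator
is killed by some `pᵏ`, and maps from `R/qᵐ` with `q ≠ p` vanish. -/
lemma exists_gen_factor {p : HeightOneSpectrum R} {N : FGModuleCat.{u} R}
    (hN : pTorsion p.asIdeal N) (i : Option (HeightOneSpectrum R × ℕ+)) (f : gen R i ⟶ N) :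
    ∃ (k : ℕ) (f' : gen R i ⟶ FGModuleCat.of R (cyc p.asIdeal k))
      (g : FGModuleCat.of R (cyc p.asIdeal k) ⟶ N), f = f' ≫ g := by
  rcases i with - | ⟨q, m⟩
  · obtain ⟨k, hk⟩ := hN (f.hom.hom (1 : R))
    refine ⟨k, FGModuleCat.ofHom (Submodule.mkQ (p.asIdeal ^ k)),
      FGModuleCat.ofHom (Submodule.liftQ (p.asIdeal ^ k) (f.hom.hom : R →ₗ[R] N) fun a ha => ?_), ?_⟩
    · have h (φ : R →ₗ[R] N) : a • φ 1 = φ a := by rw [← map_smul, smul_eq_mul, mul_one]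
      exact (h f.hom.hom).symm.trans (hk a ha)
    · apply FGModuleCat.hom_ext
      exact (Submodule.liftQ_mkQ _ _ _).symm
  · by_cases hq : q = p
    · subst hq
      exact ⟨m, 𝟙 _, f, (Category.id_comp f).symm⟩
    · obtain ⟨k, hk⟩ := hN (f.hom.hom (Ideal.Quotient.mk (q.asIdeal ^ (m : ℕ)) 1))
      refine ⟨k, 0, 0, ?_⟩
      rw [Limits.comp_zero]
      apply FGModuleCat.hom_ext
      exact hom_eq_zero_of_sup_eq_top (pow_sup_pow_eq_top hq m k) _ hk

variable (p : HeightOneSpectrum R) {x : R}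

lemma tubeSeq_shortExact (hx : x ∈ p.asIdeal) (hx' : x ∉ p.asIdeal ^ 2) {l : ℕ} (hl : l ≠ 0) :
    (tubeSeq p.asIdeal hx l).ShortExact :=
  fg_shortExact (tube_injective p hx hx' l) (tube_exact p hx hx' hl) (tube_surjective p hx l)

lemma pTorsion_of_smul_eq_zero {N : FGModuleCat.{u} R} (k : ℕ)
    (h : ∀ a ∈ p.asIdeal ^ k, ∀ y : N, a • y = 0) : pTorsion p.asIdeal N :=
  fun y => ⟨k, fun a ha => h a ha y⟩

lemma smul_cyc_eq_zero {k l : ℕ} (hkl : l ≤ k) {a : R} (ha : a ∈ p.asIdeal ^ k)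
    (y : cyc p.asIdeal l) : a • y = 0 := by
  obtain ⟨b, rfl⟩ := Ideal.Quotient.mk_surjective y
  exact Ideal.Quotient.eq_zero_iff_mem.2 (Ideal.mul_mem_right _ _ (Ideal.pow_le_pow_right hkl ha))

lemma pTorsion_cyc (l : ℕ) : pTorsion p.asIdeal (FGModuleCat.of R (cyc p.asIdeal l)) :=
  pTorsion_of_smul_eq_zero p l fun _ ha y => smul_cyc_eq_zero p le_rfl ha y

lemma tube_lift_or_isIso (hx : x ∈ p.asIdeal) (hx' : x ∉ p.asIdeal ^ 2) {m l : ℕ} (hl : l ≠ 0)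
    (f : FGModuleCat.of R (cyc p.asIdeal m) ⟶ FGModuleCat.of R (cyc p.asIdeal l)) :
    (m = l ∧ IsIso f) ∨ ∃ f' : FGModuleCat.of R (cyc p.asIdeal m) ⟶ (tubeSeq p.asIdeal hx l).X₂,
      f' ≫ (tubeSeq p.asIdeal hx l).g = f := by
  rcases cyc_lift_or_bijective p hx hx' hl f.hom.hom with ⟨h, hf⟩ | ⟨f', hf'⟩
  · exact Or.inl ⟨h, fg_isIso hf⟩
  · exact Or.inr ⟨FGModuleCat.ofHom f', FGModuleCat.hom_ext hf'⟩

lemma tube_desc_or_isIso (hx : x ∈ p.asIdeal) (hx' : x ∉ p.asIdeal ^ 2) {m l : ℕ} (hl : l ≠ 0)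
    (f : FGModuleCat.of R (cyc p.asIdeal l) ⟶ FGModuleCat.of R (cyc p.asIdeal m)) :
    (m = l ∧ IsIso f) ∨ ∃ f' : (tubeSeq p.asIdeal hx l).X₂ ⟶ FGModuleCat.of R (cyc p.asIdeal m),
      (tubeSeq p.asIdeal hx l).f ≫ f' = f := by
  rcases cyc_desc_or_bijective p hx hx' hl f.hom.hom with ⟨h, hf⟩ | ⟨f', hf'⟩
  · exact Or.inl ⟨h, fg_isIso hf⟩
  · exact Or.inr ⟨FGModuleCat.ofHom f', FGModuleCat.hom_ext hf'⟩

/-- Each component of `h` to a generator vanishes, extends, or is an isomorphism; the last would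
split `h`. No torsion assumption on `N` is needed, since maps to `R` and to other primes are zero.
-/
lemma tube_desc (hx : x ∈ p.asIdeal) (hx' : x ∉ p.asIdeal ^ 2) {l : ℕ} (hl : l ≠ 0)
    {N : FGModuleCat.{u} R} (h : (tubeSeq p.asIdeal hx l).X₁ ⟶ N) (hh : ¬ IsSplitMono h) :
    ∃ h' : (tubeSeq p.asIdeal hx l).X₂ ⟶ N, (tubeSeq p.asIdeal hx l).f ≫ h' = h := by
  obtain ⟨κ, _, j, a, b, hab⟩ := sumThrough_gen N
  have key (k : κ) : ∃ h' : (tubeSeq p.asIdeal hx l).X₂ ⟶ gen R (j k),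
      (tubeSeq p.asIdeal hx l).f ≫ h' = h ≫ a k := by
    have zero (hz : h ≫ a k = 0) : ∃ h' : (tubeSeq p.asIdeal hx l).X₂ ⟶ gen R (j k),
        (tubeSeq p.asIdeal hx l).f ≫ h' = h ≫ a k := ⟨0, by rw [hz, Limits.comp_zero]⟩
    generalize a k = a' at zero ⊢
    generalize j k = i at a' zero ⊢
    rcases i with - | ⟨q, m⟩
    · exact zero (FGModuleCat.hom_ext (cyc_hom_self_eq_zero p (h ≫ a').hom.hom))
    · by_cases hq : q = p
      · subst hq
        rcases tube_desc_or_isIso q hx hx' hl (h ≫ a') with ⟨-, ⟨i, hi, -⟩⟩ | h'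
        · exact (hh ⟨⟨⟨a' ≫ i, (Category.assoc h a' i).symm.trans hi⟩⟩⟩).elim
        · exact h'
      · exact zero (FGModuleCat.hom_ext (cyc_hom_eq_zero (Ne.symm hq) (h ≫ a').hom.hom))
  choose h' hh' using key
  refine ⟨∑ k, h' k ≫ b k, ?_⟩
  rw [← Category.comp_id h, hab, Preadditive.comp_sum, Preadditive.comp_sum]
  exact Finset.sum_congr rfl fun k _ => by rw [← Category.assoc, hh', Category.assoc]

/-- The sequence `tubeSeq` is an Auslander-Reiten sequence. -/
lemma tubeSeq_isAlmostSplit (hx : x ∈ p.asIdeal) (hx' : x ∉ p.asIdeal ^ 2) {l : ℕ} (hl : l ≠ 0) :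
    IsAlmostSplit (pTorsion p.asIdeal) (tubeSeq p.asIdeal hx l) where
  prop₁ := pTorsion_cyc p l
  prop₂ := pTorsion_of_smul_eq_zero p (l + 1) fun a ha y => Prod.ext
    (smul_cyc_eq_zero p (by omega) ha _) (smul_cyc_eq_zero p le_rfl ha _)
  prop₃ := pTorsion_cyc p l
  shortExact := tubeSeq_shortExact p hx hx' hl
  not_split := by
    rintro ⟨s⟩
    refine tube_not_split p hx hl s.s.hom.hom ?_
    have := s.s_g
    exact congr_arg (fun f => f.hom.hom) this
  lift N hN h hh := by
    obtain ⟨κ, _, j, a, b, hab⟩ := sumThrough_gen N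
    have key (k : κ) : ∃ h' : gen R (j k) ⟶ (tubeSeq p.asIdeal hx l).X₂,
        h' ≫ (tubeSeq p.asIdeal hx l).g = b k ≫ h := by
      obtain ⟨m, f', g, hg⟩ := exists_gen_factor hN (j k) (b k)
      rw [hg]
      -- If `g ≫ h` is an isomorphism, its inverse followed by `g` is a section of `h`, which is
      -- excluded.
      rcases tube_lift_or_isIso p hx hx' hl (g ≫ h) with ⟨-, ⟨i, -, hi⟩⟩ | ⟨g', hg'⟩
      · exact (hh ⟨⟨⟨i ≫ g, (Category.assoc i g h).trans hi⟩⟩⟩).elim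
      · exact ⟨f' ≫ g', by rw [Category.assoc, hg']; exact (Category.assoc f' g h).symm⟩
    choose h' hh' using key
    refine ⟨∑ k, a k ≫ h' k, ?_⟩
    rw [← Category.id_comp h, hab, Preadditive.sum_comp, Preadditive.sum_comp]
    exact Finset.sum_congr rfl fun k _ => by rw [Category.assoc, Category.assoc, hh']
  desc N _ h hh := tube_desc p hx hx' hl h hh

end AlmostSplit

/-! ### Global dimension at most one -/

section Hereditary

variable {R : Type u} [CommRing R]

lemma projective_fg_of_projective [IsNoetherianRing R] (P : FGModuleCat.{u} R)
    [Module.Projective R P] : Projective P where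
  factors {E X} f e _ := by
    obtain ⟨h, hh⟩ := Module.projective_lifting_property e.hom.hom f.hom.hom
      (surjective_of_fg_epi e)
    exact ⟨FGModuleCat.ofHom h, FGModuleCat.hom_ext hh⟩

/-- The kernel of a finite free cover is flat and finitely presented, hence projective. -/
lemma hasProjectiveDimensionLT_two [IsDedekindDomain R] (M : FGModuleCat.{u} R) :
    HasProjectiveDimensionLT M 2 := by
  obtain ⟨n, f, hf⟩ := Module.Finite.exists_fin' R M
  let S : ShortComplex (FGModuleCat.{u} R) :=
    { X₁ := FGModuleCat.of R (LinearMap.ker f)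
      X₂ := FGModuleCat.of R (Fin n → R)
      X₃ := M
      f := FGModuleCat.ofHom (LinearMap.ker f).subtype
      g := FGModuleCat.ofHom f
      zero := FGModuleCat.hom_ext (LinearMap.comp_ker_subtype f) }
  have hS : S.ShortExact := fg_shortExact (LinearMap.ker f).injective_subtype
    (LinearMap.exact_subtype_ker_map f) hf
  have : Module.FinitePresentation R (LinearMap.ker f) := Module.finitePresentation_of_finite _ _
  have : Module.Projective R (LinearMap.ker f) := Module.Flat.projective_of_finitePresentation
  have h₁ : Projective S.X₁ :=
    projective_fg_of_projective (FGModuleCat.of R (LinearMap.ker f))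
  have h₂ : Projective S.X₂ := projective_fg_of_projective (FGModuleCat.of R (Fin n → R))
  exact hS.hasProjectiveDimensionLT_X₃ 1 inferInstance inferInstance

end Hereditary

/-! ### Vanishing of morphisms between shifted stalk complexes -/

section DerivedHom

open DerivedCategory

variable {A : Type u} [Category.{v} A] [Abelian A] [HasDerivedCategory.{w} A]

lemma singleFunctor_hom_shift_eq_zero (M N : A) (n : ℕ) [HasProjectiveDimensionLT M n]
    {m : ℕ} (hm : n ≤ m) (f : (singleFunctor A 0).obj M ⟶ ((singleFunctor A 0).obj N)⟦(m : ℤ)⟧) :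
    f = 0 := by
  have := hasExt_of_hasDerivedCategory A
  obtain ⟨e, rfl⟩ := (Abelian.Ext.homEquiv.{w} (X := M) (Y := N) (n := m)).surjective f
  rw [e.eq_zero_of_hasProjectiveDimensionLT n hm]
  exact Abelian.Ext.zero_hom M N m

/-- There are no nonzero morphisms `M⟦i⟧ ⟶ N⟦j⟧` if `j < i` or if `j - i` exceeds the projective
dimension of `M`. -/
lemma singleFunctor_shift_hom_eq_zero (M N : A) (n : ℕ) [HasProjectiveDimensionLT M n] {i j : ℤ}
    (h : j < i ∨ i + n ≤ j)
    (f : ((singleFunctor A 0).obj M)⟦i⟧ ⟶ ((singleFunctor A 0).obj N)⟦j⟧) : f = 0 := by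
  rcases h with h | h
  · have := TStructure.t.isLE_shift ((singleFunctor A 0).obj M) 0 i (-i)
    have := TStructure.t.isGE_shift ((singleFunctor A 0).obj N) 0 j (-j)
    exact TStructure.t.zero f (-i) (-j)
  · obtain ⟨m, hm⟩ := Int.eq_ofNat_of_zero_le (show 0 ≤ j - i by omega)
    obtain ⟨g, hg⟩ := (shiftFunctor (DerivedCategory A) i).map_surjective
      (f ≫ (shiftFunctorAdd' (DerivedCategory A) (m : ℤ) i j (by omega)).hom.app _)
    rw [singleFunctor_hom_shift_eq_zero M N n (by omega) g, Functor.map_zero] at hg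
    rw [← cancel_mono ((shiftFunctorAdd' (DerivedCategory A) (m : ℤ) i j (by omega)).hom.app _),
      ← hg, Limits.zero_comp]

lemma stalk_shift_hom_eq_zero (M N : A) (n : ℕ) [HasProjectiveDimensionLT M n] {i j : ℤ}
    (h : j < i ∨ i + n ≤ j) (f : (stalk M)⟦i⟧ ⟶ (stalk N)⟦j⟧) : f = 0 := by
  have : ((DerivedCategory.Bounded.ι (C := A)).commShiftIso i).inv.app (stalk M) ≫
      (DerivedCategory.Bounded.ι (C := A)).map f ≫
      ((DerivedCategory.Bounded.ι (C := A)).commShiftIso j).hom.app (stalk N) = 0 :=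
    singleFunctor_shift_hom_eq_zero M N n h _
  replace this : (DerivedCategory.Bounded.ι (C := A)).map f = 0 := by
    rwa [Preadditive.IsIso.comp_left_eq_zero, Preadditive.IsIso.comp_right_eq_zero] at this
  exact (DerivedCategory.Bounded.ι (C := A)).map_injective (this.trans (Functor.map_zero _ _ _).symm)

/-- A distinguished triangle with vanishing third morphism splits. -/
lemma exists_eq_add_of_distTriang {C : Type*} [Category* C] [Preadditive C]
    [Limits.HasZeroObject C] [HasShift C ℤ] [∀ n : ℤ, (shiftFunctor C n).Additive]
    [Pretriangulated C] {X₁ X X₂ : C} (f : X₁ ⟶ X) (g : X ⟶ X₂)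
    (hT : Pretriangulated.Triangle.mk f g 0 ∈ Pretriangulated.distinguishedTriangles) :
    ∃ (r : X ⟶ X₁) (s : X₂ ⟶ X), 𝟙 X = r ≫ f + g ≫ s := by
  obtain ⟨s, hs⟩ : ∃ s : X₂ ⟶ X, 𝟙 X₂ = s ≫ g :=
    Pretriangulated.Triangle.coyoneda_exact₃ _ hT (𝟙 X₂) Limits.comp_zero
  obtain ⟨r, hr⟩ : ∃ r : X ⟶ X₁, 𝟙 X - g ≫ s = r ≫ f :=
    Pretriangulated.Triangle.coyoneda_exact₂ _ hT (𝟙 X - g ≫ s) (by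
      change (𝟙 X - g ≫ s) ≫ g = 0
      rw [Preadditive.sub_comp, Category.assoc, ← hs, Category.id_comp, Category.comp_id, sub_self])
  exact ⟨r, s, by rw [← hr, sub_add_cancel]⟩

end DerivedHom

/-! ### Generating the bounded derived category by shifted stalk complexes -/

section Generation

open DerivedCategory

lemma SumThrough.reindex {C : Type*} [Category* C] [Preadditive C] {ι κ : Type*} {S : ι → C}
    {T : κ → C} {X Y : C} {f : X ⟶ Y} (hf : SumThrough T f) (φ : κ → ι)
    (e : ∀ k, S (φ k) ≅ T k) : SumThrough S f :=
  hf.trans fun k => by simpa using SumThrough.of_comp (φ k) (e k).inv (e k).hom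

lemma SumThrough.of_map {C D : Type*} [Category* C] [Preadditive C] [Category* D] [Preadditive D]
    (F : C ⥤ D) [F.Additive] [F.Full] [F.Faithful] {ι : Type*} {S : ι → C} {X Y : C} {f : X ⟶ Y}
    (hf : SumThrough (fun i => F.obj (S i)) (F.map f)) : SumThrough S f := by
  obtain ⟨κ, _, j, a, b, h⟩ := hf
  refine ⟨κ, inferInstance, j, fun k => F.preimage (a k), fun k => F.preimage (b k),
    F.map_injective ?_⟩
  simp [h, Functor.map_sum]

variable {A : Type u} [Category.{v} A] [Abelian A] [HasDerivedCategory.{w} A]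

/-- In the derived category of an abelian category of global dimension at most one, each bounded
object is a sum of shifted stalk complexes. -/
lemma sumThrough_singleFunctor [∀ M : A, HasProjectiveDimensionLT M 2] (k : ℕ) :
    ∀ (b : ℤ) (X : DerivedCategory A) [X.IsGE (b + 1 - k)] [X.IsLE b],
      SumThrough (fun s : A × { i : ℤ // -b ≤ i } => ((singleFunctor A 0).obj s.1)⟦s.2.1⟧) (𝟙 X) := by
  -- Induction on the length `k` of the interval of degrees from `b + 1 - k` to `b`. The bound `-b ≤
  -- i` on the shifts is carried along to control the connecting morphism.
  induction k with
  | zero =>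
    intro b X _ _
    have : 𝟙 X = 0 := TStructure.t.zero (𝟙 X) b (b + 1 - (0 : ℕ))
    rw [this]
    exact SumThrough.zero _ _
  | succ k ih =>
    intro b X hX hX'
    -- Truncation splits off the top degree `b`: `X₂` becomes a single stalk shifted by `-b`.
    obtain ⟨X₁, X₂, h₁, h₂, f, g, δ, hT⟩ := TStructure.t.exists_triangle X (b - 1) b (by omega)
    rw [TStructure.t.le_iff_isLE] at h₁
    rw [TStructure.t.ge_iff_isGE] at h₂
    have hX₁ : X₁.IsGE (b - 1 + 1 - k) := by
      refine TStructure.t.isGE₂ _ (Pretriangulated.inv_rot_of_distTriang _ hT) _ ?_ ?_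
      · have := TStructure.t.isGE_shift X₂ b (-1) (b + 1)
        exact TStructure.t.isGE_of_ge (X₂⟦(-1 : ℤ)⟧) _ (b + 1)
      · exact TStructure.t.isGE_of_ge X _ (b + 1 - (k + 1 : ℕ))
    have hX₂ : X₂.IsLE b := by
      refine TStructure.t.isLE₂ _ (Pretriangulated.rot_of_distTriang _ hT) _ hX' ?_
      have := TStructure.t.isLE_shift X₁ (b - 1) 1 (b - 2)
      exact TStructure.t.isLE_of_le (X₁⟦(1 : ℤ)⟧) (b - 2) b
    have ih := ih (b - 1) X₁
    obtain ⟨M, ⟨e⟩⟩ := X₂.exists_iso_singleFunctor_obj_of_isGE_of_isLE b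
    have e' : X₂ ≅ ((singleFunctor A 0).obj M)⟦-b⟧ :=
      e ≪≫ ((singleFunctors A).shiftIso (-b) b 0 (by omega)).symm.app M
    -- After one more shift the stalks that generate `X₁` have shift at least `-b + 2`, so `δ`
    -- consists of classes in `Ext` of degree at least two.
    have hδ : δ = 0 := by
      obtain ⟨κ, _, j, a, c, h⟩ := ih
      have : δ = δ ≫ (𝟙 X₁)⟦(1 : ℤ)⟧' := by simp
      rw [this, h, Functor.map_sum, Preadditive.comp_sum]
      refine Finset.sum_eq_zero fun i _ => ?_
      have hz : e'.inv ≫ δ ≫ (a i)⟦(1 : ℤ)⟧' ≫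
          (shiftFunctorAdd' (DerivedCategory A) (j i).2.1 1 _ rfl).inv.app _ = 0 :=
        singleFunctor_shift_hom_eq_zero M (j i).1 2 (Or.inr (by have := (j i).2.2; push_cast; omega)) _
      have hz' : δ ≫ (a i)⟦(1 : ℤ)⟧' = 0 := by
        rw [← cancel_epi e'.inv, ← cancel_mono
          ((shiftFunctorAdd' (DerivedCategory A) (j i).2.1 1 _ rfl).inv.app _)]
        simpa using hz
      rw [Functor.map_comp, ← Category.assoc, hz', Limits.zero_comp]
    subst hδ
    obtain ⟨r, s, hid⟩ := exists_eq_add_of_distTriang f g hT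
    rw [hid]
    refine SumThrough.add (SumThrough.comp_id_comp _ _ ?_) (SumThrough.comp_id_comp _ _ ?_)
    · exact ih.reindex (fun t => (t.1, ⟨t.2.1, by have := t.2.2; omega⟩)) fun _ => Iso.refl _
    · refine SumThrough.id_of_iso e'.symm ?_
      simpa using SumThrough.of_comp
        (S := fun s : A × { i : ℤ // -b ≤ i } => ((singleFunctor A 0).obj s.1)⟦s.2.1⟧)
        (M, ⟨-b, le_rfl⟩) (𝟙 _) (𝟙 _)

lemma sumThrough_stalk [∀ M : A, HasProjectiveDimensionLT M 2] (X : DerivedCategory.Bounded A) :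
    SumThrough (fun s : A × ℤ => (stalk s.1)⟦s.2⟧) (𝟙 X) := by
  obtain ⟨⟨a, _⟩, ⟨b, _⟩⟩ := X.property
  refine SumThrough.of_map (DerivedCategory.Bounded.ι (C := A)) ?_
  have : X.obj.IsGE (b + 1 - (b + 1 - a).toNat) :=
    TStructure.t.isGE_of_ge X.obj _ a
  rw [CategoryTheory.Functor.map_id]
  exact (sumThrough_singleFunctor (b + 1 - a).toNat b X.obj).reindex (fun s => (s.1, s.2.1))
    fun s => ((DerivedCategory.Bounded.ι (C := A)).commShiftIso s.2.1).app (stalk s.1)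

end Generation

/-! ### Stalk complexes and classes of extensions -/

section Stalk

open DerivedCategory

variable {A : Type u} [Category.{v} A] [Abelian A] [HasDerivedCategory.{w} A]

instance bounded_shiftFunctor_linear (R : Type*) [Ring R] [Linear R A] (n : ℤ) :
    (shiftFunctor (DerivedCategory.Bounded A) n).Linear R where
  map_smul {X Y} f r := by
    apply (DerivedCategory.Bounded.ι (C := A)).map_injective
    rw [← cancel_mono (((DerivedCategory.Bounded.ι (C := A)).commShiftIso n).hom.app Y),
      Functor.commShiftIso_hom_naturality, Functor.map_smul, Functor.map_smul, Functor.map_smul,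
      Linear.comp_smul, Linear.smul_comp, Functor.commShiftIso_hom_naturality]

/-- The morphism of stalk complexes which is induced by a morphism. -/
def stalkMap {M N : A} (f : M ⟶ N) : stalk M ⟶ stalk N :=
  ObjectProperty.homMk ((singleFunctor A 0).map f)

variable (A) in
/-- The functor which sends an object to the stalk complex in degree zero. -/
abbrev stalkFunctor : A ⥤ DerivedCategory.Bounded A where
  obj := stalk
  map := stalkMap
  map_id M := ObjectProperty.hom_ext _ ((singleFunctor A 0).map_id M)
  map_comp f g := ObjectProperty.hom_ext _ ((singleFunctor A 0).map_comp f g)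

lemma stalkMap_id (M : A) : stalkMap (𝟙 M) = 𝟙 (stalk M) := (stalkFunctor A).map_id M

lemma stalkMap_comp {L M N : A} (f : L ⟶ M) (g : M ⟶ N) :
    stalkMap (f ≫ g) = stalkMap f ≫ stalkMap g := (stalkFunctor A).map_comp f g

lemma stalkMap_zero (M N : A) : stalkMap (0 : M ⟶ N) = 0 :=
  ObjectProperty.hom_ext _ ((singleFunctor A 0).map_zero M N)

lemma stalkMap_smul {R : Type*} [Ring R] [Linear R A] {M N : A} (r : R) (f : M ⟶ N) :
    stalkMap (r • f) = r • stalkMap f :=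
  ObjectProperty.hom_ext _ ((singleFunctor A 0).map_smul r f)

lemma exists_eq_stalkMap {M N : A} (f : stalk M ⟶ stalk N) : ∃ g : M ⟶ N, f = stalkMap g := by
  obtain ⟨g, hg⟩ := (singleFunctor A 0).map_surjective f.hom
  exact ⟨g, ObjectProperty.hom_ext _ hg.symm⟩

lemma stalkMap_injective {M N : A} :
    Function.Injective (stalkMap : (M ⟶ N) → (stalk M ⟶ stalk N)) := fun _ _ h =>
  (singleFunctor A 0).map_injective (congr_arg (fun f => f.hom) h)

instance : (stalkFunctor A).Additive where
  map_add {_ _ _ _} := ObjectProperty.hom_ext _ (singleFunctor A 0).map_add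

/-- The morphism in the derived category underlying a morphism `M ⟶ Σ N` in the bounded derived
category. -/
def stalkHom {M N : A} (e : stalk M ⟶ (stalk N)⟦(1 : ℤ)⟧) :
    (singleFunctor A 0).obj M ⟶ ((singleFunctor A 0).obj N)⟦(1 : ℤ)⟧ :=
  e.hom ≫ ((DerivedCategory.Bounded.ι (C := A)).commShiftIso (1 : ℤ)).hom.app (stalk N)

lemma stalkHom_injective {M N : A} :
    Function.Injective (stalkHom : (stalk M ⟶ (stalk N)⟦(1 : ℤ)⟧) → _) := fun e e' h => by
  apply (DerivedCategory.Bounded.ι (C := A)).map_injective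
  exact (cancel_mono (((DerivedCategory.Bounded.ι (C := A)).commShiftIso (1 : ℤ)).hom.app
    (stalk N))).1 h

lemma stalkHom_zero (M N : A) : stalkHom (0 : stalk M ⟶ (stalk N)⟦(1 : ℤ)⟧) = 0 :=
  Limits.zero_comp

lemma stalkHom_comp {L M N : A} (f : L ⟶ M) (e : stalk M ⟶ (stalk N)⟦(1 : ℤ)⟧) :
    stalkHom (stalkMap f ≫ e) = (singleFunctor A 0).map f ≫ stalkHom e :=
  Category.assoc _ _ _

lemma stalkHom_comp_shift {L M N : A} (e : stalk L ⟶ (stalk M)⟦(1 : ℤ)⟧) (f : M ⟶ N) :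
    stalkHom (e ≫ (stalkMap f)⟦(1 : ℤ)⟧') =
      stalkHom e ≫ ((singleFunctor A 0).map f)⟦(1 : ℤ)⟧' := by
  have h := (DerivedCategory.Bounded.ι (C := A)).commShiftIso_hom_naturality (stalkMap f) (1 : ℤ)
  exact ((Category.assoc _ _ _).trans (congr_arg (e.hom ≫ ·) h)).trans (Category.assoc _ _ _).symm

variable {S : ShortComplex A} (hS : S.ShortExact)

lemma stalkHom_extClass : stalkHom (extClass hS) = hS.singleδ := by
  have h := ((DerivedCategory.Bounded.ι (C := A)).commShiftIso (1 : ℤ)).inv_hom_id_app (stalk S.X₁)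
  exact (Category.assoc _ _ _).trans ((congr_arg (hS.singleδ ≫ ·) h).trans (Category.comp_id _))

lemma comp_extClass {N : A} (h : N ⟶ S.X₂) :
    stalkMap (h ≫ S.g) ≫ extClass hS = 0 := by
  apply stalkHom_injective
  have := Pretriangulated.comp_distTriang_mor_zero₂₃ _ hS.singleTriangle_distinguished
  rw [stalkHom_comp, stalkHom_extClass, stalkHom_zero, Functor.map_comp, Category.assoc]
  exact (congr_arg ((singleFunctor A 0).map h ≫ ·) this).trans Limits.comp_zero

lemma extClass_comp {N : A} (h : S.X₂ ⟶ N) :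
    extClass hS ≫ (stalkMap (S.f ≫ h))⟦(1 : ℤ)⟧' = 0 := by
  apply stalkHom_injective
  have := Pretriangulated.comp_distTriang_mor_zero₃₁ _ hS.singleTriangle_distinguished
  rw [stalkHom_comp_shift, stalkHom_extClass, stalkHom_zero, Functor.map_comp, Functor.map_comp,
    ← Category.assoc]
  exact (congr_arg (· ≫ ((singleFunctor A 0).map h)⟦(1 : ℤ)⟧') this).trans Limits.zero_comp

lemma splitting_of_extClass_eq_zero (h : extClass hS = 0) : Nonempty S.Splitting := by
  have hδ : hS.singleδ = 0 := by rw [← stalkHom_extClass, h, stalkHom_zero]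
  obtain ⟨s, hs⟩ : ∃ s, 𝟙 ((singleFunctor A 0).obj S.X₃) = s ≫ (singleFunctor A 0).map S.g :=
    Pretriangulated.Triangle.coyoneda_exact₃ _ hS.singleTriangle_distinguished (𝟙 _)
      ((congr_arg (𝟙 _ ≫ ·) hδ).trans Limits.comp_zero)
  refine ⟨ShortComplex.Splitting.ofExactOfSection S hS.exact ((singleFunctor A 0).preimage s) ?_
    hS.mono_f⟩
  apply (singleFunctor A 0).map_injective
  rw [Functor.map_comp, Functor.map_preimage, ← hs, CategoryTheory.Functor.map_id]

/-- If each morphism from `S.X₁` which is not a split monomorphism factors through `S.X₂`, then the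
class of `S` is a multiple of each nonzero class in `Ext¹(M, S.X₁)`. -/
lemma exists_comp_eq_extClass
    (hdesc : ∀ (N : A) (h : S.X₁ ⟶ N), ¬ IsSplitMono h → ∃ h' : S.X₂ ⟶ N, S.f ≫ h' = h)
    {M : A} {e : stalk M ⟶ (stalk S.X₁)⟦(1 : ℤ)⟧} (he : e ≠ 0) :
    ∃ h : S.X₃ ⟶ M, stalkMap h ≫ e = extClass hS := by
  -- Realise `e` as an extension: its middle term lies in degree zero, hence is a module.
  obtain ⟨E, f, g, hT⟩ := Pretriangulated.distinguished_cocone_triangle₂ (stalkHom e)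
  have : E.IsGE 0 := TStructure.t.isGE₂ _ hT 0
    (inferInstanceAs (((singleFunctor A 0).obj S.X₁).IsGE 0))
    (inferInstanceAs (((singleFunctor A 0).obj M).IsGE 0))
  have : E.IsLE 0 := TStructure.t.isLE₂ _ hT 0
    (inferInstanceAs (((singleFunctor A 0).obj S.X₁).IsLE 0))
    (inferInstanceAs (((singleFunctor A 0).obj M).IsLE 0))
  obtain ⟨N, ⟨φ⟩⟩ := E.exists_iso_singleFunctor_obj_of_isGE_of_isLE 0
  obtain ⟨i, hi⟩ := (singleFunctor A 0).map_surjective (f ≫ φ.hom)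
  have hef : stalkHom e ≫ f⟦(1 : ℤ)⟧' = 0 :=
    Pretriangulated.comp_distTriang_mor_zero₃₁ _ hT
  -- A retraction of the inclusion into the middle term would force `e = 0`.
  have hsplit : ¬ IsSplitMono i := by
    rintro ⟨⟨r, hr⟩⟩
    refine he (stalkHom_injective ?_)
    have hfr : f ≫ φ.hom ≫ (singleFunctor A 0).map r = 𝟙 _ := by
      rw [← Category.assoc, ← hi, ← Functor.map_comp, hr, CategoryTheory.Functor.map_id]
    rw [stalkHom_zero, ← Category.comp_id (stalkHom e), ← CategoryTheory.Functor.map_id, ← hfr, Functor.map_comp,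
      ← Category.assoc, hef, Limits.zero_comp]
  obtain ⟨h', hh'⟩ := hdesc N i hsplit
  -- The inclusion thus factors through `S.f`, so it kills the class of `S`; exactness then factors
  -- that class through `e`.
  have hσ : hS.singleδ ≫ f⟦(1 : ℤ)⟧' = 0 := by
    have hfi : f = (singleFunctor A 0).map i ≫ φ.inv := by rw [hi]; simp
    have := congr_arg stalkHom (extClass_comp hS h')
    rw [stalkHom_comp_shift, stalkHom_extClass, stalkHom_zero, hh'] at this
    rw [hfi, Functor.map_comp, ← Category.assoc, this, Limits.zero_comp]
  obtain ⟨k, hk⟩ : ∃ k : (singleFunctor A 0).obj S.X₃ ⟶ (singleFunctor A 0).obj M,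
      hS.singleδ = k ≫ stalkHom e := Pretriangulated.Triangle.coyoneda_exact₁ _ hT hS.singleδ hσ
  refine ⟨(singleFunctor A 0).preimage k, stalkHom_injective ?_⟩
  rw [stalkHom_comp, stalkHom_extClass, hk, Functor.map_preimage]

end Stalk

/-! ### Components on shifts, signs and scalars in the graded center -/

section CenterGeneral

variable {C : Type u} [Category.{v} C] [Preadditive C] [HasShift C ℤ]
  [∀ n : ℤ, (shiftFunctor C n).Additive]

lemma centerApp_eq_zero_of_iso {n : ℤ} (η : centerDegree C n) {X Y : C} (e : X ≅ Y)
    (h : centerApp η X = 0) : centerApp η Y = 0 := by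
  have := centerApp_naturality η e.hom
  rw [h, Limits.zero_comp] at this
  rwa [← Preadditive.IsIso.comp_left_eq_zero e.hom]

lemma centerApp_shift_one_eq_zero_iff {n : ℤ} (η : centerDegree C n) (X : C) :
    centerApp η (X⟦(1 : ℤ)⟧) = 0 ↔ centerApp η X = 0 := by
  rw [centerApp_shift, smul_eq_zero_iff_eq, Preadditive.IsIso.comp_right_eq_zero]
  exact ⟨fun h => (shiftFunctor C (1 : ℤ)).map_injective (h.trans (Functor.map_zero _ _ _).symm),
    fun h => by rw [h, Functor.map_zero]⟩

lemma centerApp_shift_eq_zero {n : ℤ} (η : centerDegree C n) {X : C} (h : centerApp η X = 0)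
    (i : ℤ) : centerApp η (X⟦i⟧) = 0 := by
  induction i using Int.induction_on with
  | zero => exact centerApp_eq_zero_of_iso η ((shiftFunctorZero C ℤ).symm.app X) h
  | succ i ih =>
    exact centerApp_eq_zero_of_iso η ((shiftFunctorAdd' C (i : ℤ) 1 _ rfl).symm.app X)
      ((centerApp_shift_one_eq_zero_iff η _).2 ih)
  | pred i ih =>
    refine (centerApp_shift_one_eq_zero_iff η _).1 ?_
    exact centerApp_eq_zero_of_iso η ((shiftFunctorAdd' C (-(i : ℤ) - 1) 1 _ (by ring)).app X) ih

/-- The morphism `Σⁿ X ⟶ Σ Σⁿ X` which is induced by `t : X ⟶ Σ X`, with the sign `(-1)ⁿ`. -/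
def shiftedEndo {X : C} (t : X ⟶ X⟦(1 : ℤ)⟧) (n : ℤ) : X⟦n⟧ ⟶ X⟦n⟧⟦(1 : ℤ)⟧ :=
  n.negOnePow • (t⟦n⟧' ≫ (shiftFunctorComm C 1 n).hom.app X)

lemma shiftedEndo_naturality {X Y : C} {s : X ⟶ X⟦(1 : ℤ)⟧} {t : Y ⟶ Y⟦(1 : ℤ)⟧} (f : X ⟶ Y)
    (h : f ≫ t = s ≫ f⟦(1 : ℤ)⟧') (n : ℤ) :
    f⟦n⟧' ≫ shiftedEndo t n = shiftedEndo s n ≫ f⟦n⟧'⟦(1 : ℤ)⟧' := by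
  have nat := (shiftFunctorComm C 1 n).hom.naturality f
  dsimp at nat
  rw [shiftedEndo, shiftedEndo, Linear.comp_units_smul, Linear.units_smul_comp, Category.assoc,
    ← nat, ← Functor.map_comp_assoc, ← Functor.map_comp_assoc, h]

lemma shiftedEndo_zero {X : C} (t : X ⟶ X⟦(1 : ℤ)⟧) :
    shiftedEndo t 0 ≫ ((shiftFunctorZero C ℤ).hom.app X)⟦(1 : ℤ)⟧' =
      (shiftFunctorZero C ℤ).hom.app X ≫ t := by
  have nat := (shiftFunctorZero C ℤ).hom.naturality t
  dsimp at nat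
  rw [shiftedEndo, Int.negOnePow_zero, one_smul, Category.assoc, ← shiftFunctorZero_hom_app_shift,
    nat]

/-- This is the sign condition of the graded center on `X⟦n⟧`, the reason for the factor `(-1)ⁿ` in
`shiftedEndo`. -/
lemma shiftedEndo_succ {X : C} (t : X ⟶ X⟦(1 : ℤ)⟧) (n : ℤ) :
    shiftedEndo t (n + 1) ≫ ((shiftFunctorAdd C n 1).hom.app X)⟦(1 : ℤ)⟧' =
      (shiftFunctorAdd C n 1).hom.app X ≫
        ((1 : ℤ).negOnePow • ((shiftedEndo t n)⟦(1 : ℤ)⟧' ≫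
          (shiftFunctorComm C 1 1).hom.app (X⟦n⟧))) := by
  have nat := (shiftFunctorAdd C n 1).hom.naturality t
  dsimp at nat
  have map_smul' (u : ℤˣ) {Y Z : C} (f : Y ⟶ Z) :
      (u • f)⟦(1 : ℤ)⟧' = u • f⟦(1 : ℤ)⟧' := by
    rcases Int.units_eq_one_or u with rfl | rfl <;> simp
  rw [shiftedEndo, shiftedEndo, Linear.units_smul_comp, Category.assoc,
    shiftFunctorComm_hom_app_comp_shift_shiftFunctorAdd_hom_app, map_smul', Linear.units_smul_comp,
    Linear.comp_units_smul, Linear.comp_units_smul, smul_smul, Functor.map_comp, Category.assoc,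
    reassoc_of% nat, Int.negOnePow_add, mul_comm]

variable {R : Type*} [CommRing R] [Linear R C] [∀ n : ℤ, (shiftFunctor C n).Linear R]

/-- Multiplication of an element of the graded center with a scalar. -/
def centerSMul {n : ℤ} (r : R) (η : centerDegree C n) : centerDegree C n :=
  ⟨{ app := fun X => r • centerApp η X
     naturality := fun X Y f => by
      have := centerApp_naturality η f
      dsimp
      rw [Linear.comp_smul, Linear.smul_comp, this] }, fun X => by
      change r • centerApp η _ = _ • ((r • centerApp η X)⟦(1 : ℤ)⟧' ≫ _)
      rw [centerApp_shift, Functor.map_smul, Linear.smul_comp, smul_comm]⟩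

lemma centerApp_smul {n : ℤ} (r : R) (η : centerDegree C n) (X : C) :
    centerApp (centerSMul r η) X = r • centerApp η X := rfl

lemma centerApp_smul_one (r : R) (X : C) :
    centerApp (centerSMul r (centerOne : centerDegree C 0)) X =
      ShiftedHom.mk₀ (0 : ℤ) rfl (r • 𝟙 X) := by
  rw [centerApp_smul, centerApp_one, ShiftedHom.mk₀_smul]

lemma centerMul_smul_one {n c : ℤ} (h : n + 0 = c) (h' : n = c) (r : R) (η : centerDegree C n)
    (X : C) :
    centerApp (centerMul h η (centerSMul r centerOne)) X = h' ▸ (r • centerApp η X) := by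
  subst h'
  rw [centerApp_mul, centerApp_smul_one, ShiftedHom.mk₀_comp, Linear.smul_comp, Category.id_comp]

lemma centerMul_smul_one' {n c : ℤ} (h : 0 + n = c) (h' : n = c) (r : R) (η : centerDegree C n)
    (X : C) :
    centerApp (centerMul h (centerSMul r centerOne) η) X = h' ▸ (r • centerApp η X) := by
  subst h'
  rw [centerApp_mul, centerApp_smul_one, ShiftedHom.comp_mk₀, Functor.map_smul, Linear.comp_smul,
    CategoryTheory.Functor.map_id, Category.comp_id]

end CenterGeneral

/-! ### The graded center of a hereditary category via stalk complexes -/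

section CenterStalk

open DerivedCategory

variable {A : Type u} [Category.{v} A] [Abelian A] [HasDerivedCategory.{w} A]

lemma stalk_hom_shift_eq_zero (M N : A) (n : ℕ) [HasProjectiveDimensionLT M n] {j : ℤ}
    (h : j < 0 ∨ n ≤ j) (f : stalk M ⟶ (stalk N)⟦j⟧) : f = 0 := by
  rw [← Preadditive.IsIso.comp_left_eq_zero ((shiftFunctorZero (Bounded A) ℤ).hom.app (stalk M))]
  exact stalk_shift_hom_eq_zero M N n (by rwa [zero_add]) _

variable [∀ M : A, HasProjectiveDimensionLT M 2]

/-- An element of the graded center of the bounded derived category of a hereditary abelian category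
is determined by its components on stalk complexes. -/
lemma center_eq_zero {n : ℤ} {η : centerDegree (Bounded A) n}
    (h : ∀ M : A, centerApp η (stalk M) = 0) : η = 0 := by
  apply centerDegree_ext
  intro X
  exact (sumThrough_stalk X).app_eq_zero (τ := η.1) fun s => centerApp_shift_eq_zero η (h s.1) s.2

lemma center_eq_zero_of_ne {n : ℤ} (h₀ : n ≠ 0) (h₁ : n ≠ 1) (η : centerDegree (Bounded A) n) :
    η = 0 :=
  center_eq_zero fun M => stalk_hom_shift_eq_zero M M 2 (by push_cast; omega) _

/-- For `m < n` both sides lie in an `Ext` group of degree at least two; for `m = n` the morphism is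
a shifted map of objects of `A`; for `m > n` it is zero. -/
lemma shiftedEndo_stalk_naturality (τ : ∀ M : A, stalk M ⟶ (stalk M)⟦(1 : ℤ)⟧)
    (hτ : ∀ (M N : A) (f : M ⟶ N), stalkMap f ≫ τ N = τ M ≫ (stalkMap f)⟦(1 : ℤ)⟧') {M N : A}
    {m n : ℤ} (f : (stalk M)⟦m⟧ ⟶ (stalk N)⟦n⟧) :
    f ≫ shiftedEndo (τ N) n = shiftedEndo (τ M) m ≫ f⟦(1 : ℤ)⟧' := by
  rcases lt_trichotomy m n with h | rfl | h
  · have hz (g : (stalk M)⟦m⟧ ⟶ (stalk N)⟦n⟧⟦(1 : ℤ)⟧) : g = 0 := by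
      rw [← Preadditive.IsIso.comp_right_eq_zero _
        ((shiftFunctorAdd' (Bounded A) n 1 _ rfl).inv.app (stalk N))]
      exact stalk_shift_hom_eq_zero M N 2 (Or.inr (by push_cast; omega)) _
    rw [hz (f ≫ _), hz (_ ≫ f⟦(1 : ℤ)⟧')]
  · obtain ⟨g, rfl⟩ := (shiftFunctor (Bounded A) m).map_surjective f
    obtain ⟨g, rfl⟩ := exists_eq_stalkMap g
    exact shiftedEndo_naturality _ (hτ M N g) m
  · rw [stalk_shift_hom_eq_zero M N 2 (Or.inl h) f, Functor.map_zero, Limits.zero_comp,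
      Limits.comp_zero]

/-- A natural family of classes in `Ext¹(M, M)` extends to an element of degree one in the graded
center. -/
lemma exists_center_extending (τ : ∀ M : A, stalk M ⟶ (stalk M)⟦(1 : ℤ)⟧)
    (hτ : ∀ (M N : A) (f : M ⟶ N), stalkMap f ≫ τ N = τ M ≫ (stalkMap f)⟦(1 : ℤ)⟧') :
    ∃ η : centerDegree (Bounded A) 1, ∀ M, centerApp η (stalk M) = τ M := by
  obtain ⟨η, hη⟩ := exists_natTrans_extending (F := 𝟭 (Bounded A))
    (G := shiftFunctor (Bounded A) (1 : ℤ)) (sumThrough_stalk (A := A))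
    (fun s => shiftedEndo (τ s.1) s.2) fun s t f => shiftedEndo_stalk_naturality τ hτ f
  refine ⟨⟨η, fun X => ?_⟩, fun M => ?_⟩
  -- Both sides of the sign condition are natural, so it is enough to compare them on shifted
  -- stalks.
  · let η₁ : shiftFunctor (Bounded A) (1 : ℤ) ⟶
        shiftFunctor (Bounded A) (1 : ℤ) ⋙ shiftFunctor (Bounded A) (1 : ℤ) :=
      { app := fun X => η.app (X⟦(1 : ℤ)⟧)
        naturality := fun X Y f => η.naturality (f⟦(1 : ℤ)⟧') }
    let η₂ : shiftFunctor (Bounded A) (1 : ℤ) ⟶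
        shiftFunctor (Bounded A) (1 : ℤ) ⋙ shiftFunctor (Bounded A) (1 : ℤ) :=
      { app := fun X => (1 : ℤ).negOnePow • ((η.app X)⟦(1 : ℤ)⟧' ≫
          (shiftFunctorComm (Bounded A) (1 : ℤ) (1 : ℤ)).hom.app X)
        naturality := fun X Y f => by
          have h₁ := η.naturality f
          have h₂ := (shiftFunctorComm (Bounded A) (1 : ℤ) (1 : ℤ)).hom.naturality f
          dsimp at h₁ h₂ ⊢
          rw [Linear.comp_units_smul, Linear.units_smul_comp, Category.assoc, ← h₂,
            ← Functor.map_comp_assoc, ← Functor.map_comp_assoc, h₁] }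
    refine (sumThrough_stalk X).app_eq (τ := η₁) (τ' := η₂) fun s => ?_
    have h₁ := η.naturality ((shiftFunctorAdd (Bounded A) s.2 1).hom.app (stalk s.1))
    have h₂ := shiftedEndo_succ (τ s.1) s.2
    have h₃ : η.app ((stalk s.1)⟦s.2 + 1⟧) = shiftedEndo (τ s.1) (s.2 + 1) := hη (s.1, s.2 + 1)
    have h₄ : η.app ((stalk s.1)⟦s.2⟧) = shiftedEndo (τ s.1) s.2 := hη s
    rw [← cancel_epi ((shiftFunctorAdd (Bounded A) s.2 1).hom.app (stalk s.1))]
    have h₅ : η₂.app ((stalk s.1)⟦s.2⟧) = (1 : ℤ).negOnePow • ((η.app ((stalk s.1)⟦s.2⟧))⟦(1 : ℤ)⟧' ≫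
      (shiftFunctorComm (Bounded A) (1 : ℤ) (1 : ℤ)).hom.app _) := rfl
    rw [h₅, h₄]
    exact h₁.trans ((congr_arg (· ≫ ((shiftFunctorAdd (Bounded A) s.2 1).hom.app
      (stalk s.1))⟦(1 : ℤ)⟧') h₃).trans h₂)
  · have h₁ := η.naturality ((shiftFunctorZero (Bounded A) ℤ).hom.app (stalk M))
    have h₂ : η.app ((stalk M)⟦(0 : ℤ)⟧) = shiftedEndo (τ M) 0 := hη (M, 0)
    have h₃ := shiftedEndo_zero (τ M)
    rw [h₂] at h₁
    exact (cancel_epi ((shiftFunctorZero (Bounded A) ℤ).hom.app (stalk M))).1 (h₁.trans h₃)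

end CenterStalk

/-! ### Degrees zero and one over a Dedekind domain -/

section CenterDedekind

open DerivedCategory

variable {R : Type u} [CommRing R] [IsDedekindDomain R]
  [HasDerivedCategory.{w} (FGModuleCat.{u} R)]

instance (M : FGModuleCat.{u} R) : HasProjectiveDimensionLT M 2 := hasProjectiveDimensionLT_two M

lemma center_eq_zero_of_gen {n : ℤ} {η : centerDegree (DbMod.{w} R) n}
    (h : ∀ i, centerApp η (stalk (gen R i)) = 0) : η = 0 := by
  refine center_eq_zero fun M => ?_
  let τ : stalkFunctor (FGModuleCat.{u} R) ⟶
      stalkFunctor (FGModuleCat.{u} R) ⋙ shiftFunctor (DbMod.{w} R) n :=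
    { app := fun M => centerApp η (stalk M)
      naturality := fun M N f => centerApp_naturality η (stalkMap f) }
  exact (sumThrough_gen M).app_eq_zero (τ := τ) h

/-! ### Degree zero -/

/-- The element of degree zero in the graded center which is given by multiplication with `r`. -/
def centerScalar (r : R) : centerDegree (DbMod.{w} R) 0 := centerSMul r centerOne

lemma centerApp_scalar (r : R) (X : DbMod.{w} R) :
    centerApp (centerScalar r) X = ShiftedHom.mk₀ (0 : ℤ) rfl (r • 𝟙 X) :=
  centerApp_smul_one r X

lemma fg_hom_self_eq_smul (f : FGModuleCat.of R R ⟶ FGModuleCat.of R R) :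
    ∃ r : R, f = r • 𝟙 _ := by
  let φ : R →ₗ[R] R := f.hom.hom
  refine ⟨φ 1, FGModuleCat.hom_ext ?_⟩
  change φ = φ 1 • LinearMap.id
  ext
  simp

lemma mk₀_bijective {C : Type*} [Category* C] [HasShift C ℤ] (X Y : C) :
    Function.Bijective (ShiftedHom.mk₀ (0 : ℤ) rfl : (X ⟶ Y) → ShiftedHom X Y (0 : ℤ)) :=
  (ShiftedHom.homEquiv (X := X) (Y := Y) (0 : ℤ) rfl).bijective

lemma centerScalar_injective :
    Function.Injective (centerScalar : R → centerDegree (DbMod.{w} R) 0) := by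
  intro r s h
  have h₁ : r • 𝟙 (stalk (FGModuleCat.of R R)) = s • 𝟙 (stalk (FGModuleCat.of R R)) := by
    apply (mk₀_bijective _ _).1
    rw [← centerApp_scalar, ← centerApp_scalar, h]
  rw [← stalkMap_id, ← stalkMap_smul, ← stalkMap_smul] at h₁
  have h₂ := congr_arg (fun f => f.hom.hom (1 : R)) (stalkMap_injective h₁)
  change r • (1 : R) = s • (1 : R) at h₂
  simpa using h₂

/-- Subtracting the scalar by which `ζ` acts on `R` leaves an element vanishing on `R`. Naturality
along the maps `R ⟶ M`, one for each element of `M`, makes it vanish on every `M`. -/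
lemma centerScalar_surjective :
    Function.Surjective (centerScalar : R → centerDegree (DbMod.{w} R) 0) := by
  intro ζ
  obtain ⟨f, hf⟩ := (mk₀_bijective _ _).2 (centerApp ζ (stalk (FGModuleCat.of R R)))
  obtain ⟨f, rfl⟩ := exists_eq_stalkMap f
  obtain ⟨r, rfl⟩ := fg_hom_self_eq_smul f
  refine ⟨r, (sub_eq_zero.1 (center_eq_zero fun M => ?_)).symm⟩
  have h₀ : centerApp (ζ - centerScalar r) (stalk (FGModuleCat.of R R)) = 0 := by
    change centerApp ζ (stalk (FGModuleCat.of R R)) -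
      centerApp (centerScalar r) (stalk (FGModuleCat.of R R)) = 0
    rw [centerApp_scalar, ← hf, stalkMap_smul, stalkMap_id, sub_self]
  obtain ⟨g, hg⟩ := (mk₀_bijective _ _).2 (centerApp (ζ - centerScalar r) (stalk M))
  obtain ⟨g, rfl⟩ := exists_eq_stalkMap g
  have hzero (m : FGModuleCat.of R R ⟶ M) : m ≫ g = 0 := by
    apply stalkMap_injective
    apply (mk₀_bijective _ _).1
    have := centerApp_naturality (ζ - centerScalar r) (stalkMap m)
    rw [h₀, Limits.zero_comp, ← hg, ShiftedHom.mk₀, ← Category.assoc, ← stalkMap_comp] at this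
    rw [stalkMap_zero, ShiftedHom.mk₀_zero]
    exact this
  have : g = 0 := by
    apply FGModuleCat.hom_ext
    ext y
    have := congr_arg (fun f => f.hom.hom (1 : R))
      (hzero (FGModuleCat.ofHom (LinearMap.toSpanSingleton R M y)))
    change g.hom.hom ((1 : R) • y) = 0 at this
    rwa [one_smul] at this
  rw [← hg, this, stalkMap_zero, ShiftedHom.mk₀_zero]

/-! ### Degree one -/

/-- The module `R/pˡ`. -/
abbrev cycObj (p : HeightOneSpectrum R) (l : ℕ) : FGModuleCat.{u} R :=
  FGModuleCat.of R (cyc p.asIdeal l)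

lemma cycObj_end_eq_smul {p : HeightOneSpectrum R} {l : ℕ} (f : cycObj p l ⟶ cycObj p l) :
    ∃ c : R, f = c • 𝟙 _ := by
  obtain ⟨c, h, hf⟩ := exists_eq_quotMul f.hom.hom
  refine ⟨c, FGModuleCat.hom_ext ?_⟩
  rw [hf]
  ext
  rfl

lemma smul_id_cycObj_eq_zero {p : HeightOneSpectrum R} {l : ℕ} {a : R} (ha : a ∈ p.asIdeal ^ l) :
    a • 𝟙 (cycObj p l) = 0 := by
  apply FGModuleCat.hom_ext
  ext
  exact smul_cyc_eq_zero p le_rfl ha (Ideal.Quotient.mk _ 1)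

variable {p : HeightOneSpectrum R} {x : R} (hx : x ∈ p.asIdeal) (hx' : x ∉ p.asIdeal ^ 2)

/-- The class of the Auslander-Reiten sequence ending in `R/pˡ`. -/
def tubeClass {l : ℕ} (hl : l ≠ 0) : stalk (cycObj p l) ⟶ (stalk (cycObj p l))⟦(1 : ℤ)⟧ :=
  extClass (tubeSeq_shortExact p hx hx' hl)

/-- A map between cyclic modules of different length lifts to the middle term, and there the class
becomes zero. -/
lemma stalkMap_comp_tubeClass {l m : ℕ} (hl : l ≠ 0) (hm : m ≠ l) (f : cycObj p m ⟶ cycObj p l) :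
    stalkMap f ≫ tubeClass.{w} hx hx' hl = 0 := by
  rcases tube_lift_or_isIso p hx hx' hl f with ⟨h, -⟩ | ⟨f', rfl⟩
  · exact (hm h).elim
  · exact comp_extClass (tubeSeq_shortExact p hx hx' hl) f'

lemma tubeClass_comp_stalkMap {l m : ℕ} (hl : l ≠ 0) (hm : m ≠ l) (f : cycObj p l ⟶ cycObj p m) :
    tubeClass.{w} hx hx' hl ≫ (stalkMap f)⟦(1 : ℤ)⟧' = 0 := by
  rcases tube_desc_or_isIso p hx hx' hl f with ⟨h, -⟩ | ⟨f', rfl⟩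
  · exact (hm h).elim
  · exact extClass_comp (tubeSeq_shortExact p hx hx' hl) f'

lemma smul_eq_stalkMap_comp {M N : FGModuleCat.{u} R} (a : R) (e : stalk M ⟶ (stalk N)⟦(1 : ℤ)⟧) :
    a • e = stalkMap (a • 𝟙 M) ≫ e := by
  rw [stalkMap_smul, stalkMap_id, Linear.smul_comp, Category.id_comp]

/-- Multiplication with `a ∈ p` is not bijective on `R/pˡ`, so it lifts along the sequence. -/
lemma smul_tubeClass_eq_zero {l : ℕ} (hl : l ≠ 0) {a : R} (ha : a ∈ p.asIdeal) :
    a • tubeClass.{w} hx hx' hl = 0 := by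
  rw [smul_eq_stalkMap_comp]
  rcases cyc_lift_or_bijective p hx hx' hl (a • LinearMap.id : cyc p.asIdeal l →ₗ[R] _) with
    ⟨-, h⟩ | ⟨f', hf'⟩
  · obtain ⟨b, hb⟩ := h.2 (Ideal.Quotient.mk _ 1)
    obtain ⟨b, rfl⟩ := Ideal.Quotient.mk_surjective b
    replace hb : Ideal.Quotient.mk (p.asIdeal ^ l) (a * b) = Ideal.Quotient.mk _ 1 := hb
    rw [Ideal.Quotient.mk_eq_mk_iff_sub_mem] at hb
    refine (p.isPrime.one_notMem ?_).elim
    have := sub_mem (Ideal.mul_mem_right b _ ha) (pow_asIdeal_le_asIdeal p hl hb)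
    rwa [sub_sub_cancel] at this
  · have : a • 𝟙 (cycObj p l) = FGModuleCat.ofHom f' ≫ (tubeSeq p.asIdeal hx l).g :=
      FGModuleCat.hom_ext hf'.symm
    rw [this]
    exact comp_extClass (tubeSeq_shortExact p hx hx' hl) (FGModuleCat.ofHom f')

lemma tubeClass_ne_zero {l : ℕ} (hl : l ≠ 0) : tubeClass.{w} hx hx' hl ≠ 0 := fun h =>
  (tubeSeq_isAlmostSplit p hx hx' hl).not_split
    (splitting_of_extClass_eq_zero (tubeSeq_shortExact p hx hx' hl) h)

lemma eq_smul_of_smul_sub_one {M N : FGModuleCat.{u} R} {e : stalk M ⟶ (stalk N)⟦(1 : ℤ)⟧}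
    (he : ∀ a ∈ p.asIdeal, a • e = 0) {r : R} (hr : r ∉ p.asIdeal) : ∃ d : R, e = d • r • e := by
  obtain ⟨d, hd⟩ := exists_mul_sub_one_mem_pow p hr 1
  rw [pow_one] at hd
  refine ⟨d, ?_⟩
  have := he _ hd
  rw [sub_smul, one_smul, mul_smul, sub_eq_zero] at this
  exact this.symm

lemma smul_tubeClass_eq_zero_iff {l : ℕ} (hl : l ≠ 0) (r : R) :
    r • tubeClass.{w} hx hx' hl = 0 ↔ r ∈ p.asIdeal := by
  refine ⟨fun h => ?_, smul_tubeClass_eq_zero hx hx' hl⟩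
  by_contra hr
  obtain ⟨d, hd⟩ := eq_smul_of_smul_sub_one
    (fun a ha => smul_tubeClass_eq_zero.{w} hx hx' hl ha) hr
  rw [h, smul_zero] at hd
  exact tubeClass_ne_zero hx hx' hl hd

/-- The Auslander–Reiten class is `c • e` for any nonzero `e`. As it is nonzero and `p` kills `e`,
`c` lies outside `p` and can be inverted on `e`. -/
lemma exists_eq_smul_tubeClass {l : ℕ} (hl : l ≠ 0)
    {e : stalk (cycObj p l) ⟶ (stalk (cycObj p l))⟦(1 : ℤ)⟧}
    (he : ∀ a ∈ p.asIdeal, a • e = 0) : ∃ r : R, e = r • tubeClass.{w} hx hx' hl := by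
  by_cases he0 : e = 0
  · exact ⟨0, by rw [he0, zero_smul]⟩
  obtain ⟨h, hh⟩ : ∃ h : cycObj p l ⟶ cycObj p l, stalkMap h ≫ e = tubeClass.{w} hx hx' hl :=
    exists_comp_eq_extClass (tubeSeq_shortExact p hx hx' hl)
      (fun N h hs => tube_desc p hx hx' hl h hs) he0
  obtain ⟨c, rfl⟩ := cycObj_end_eq_smul h
  rw [← smul_eq_stalkMap_comp] at hh
  have hc : c ∉ p.asIdeal := fun hc => tubeClass_ne_zero.{w} hx hx' hl (by rw [← hh, he c hc])
  obtain ⟨d, hd⟩ := eq_smul_of_smul_sub_one he hc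
  exact ⟨d, by rw [← hh, ← hd]⟩

/-- The component on `R/pˡ` of a degree one element of the graded center is a multiple of the class
of the Auslander-Reiten sequence. -/
lemma exists_centerApp_eq_smul_tubeClass (η : centerDegree (DbMod.{w} R) 1) (l : ℕ) (hl : l ≠ 0) :
    ∃ r : R, centerApp η (stalk (cycObj p l)) = r • tubeClass.{w} hx hx' hl := by
  induction l with
  | zero => exact (hl rfl).elim
  | succ l ih =>
    refine exists_eq_smul_tubeClass hx hx' hl fun a ha => ?_
    -- On `R/pˡ⁺¹` each `a ∈ p` acts as `x d`, so only `x` needs to be treated.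
    obtain ⟨d, -, hd⟩ := exists_sub_mul_mem_pow p hx hx' (l + 1) (n := 0) (by simpa using ha)
    have h₁ : (a - x * d) • centerApp η (stalk (cycObj p (l + 1))) = 0 := by
      rw [smul_eq_stalkMap_comp, smul_id_cycObj_eq_zero hd, stalkMap_zero, Limits.zero_comp]
    have h₂ : x • centerApp η (stalk (cycObj p (l + 1))) = 0 := by
      let π : cycObj p (l + 1) ⟶ cycObj p l := FGModuleCat.ofHom (cycProj p.asIdeal (Nat.le_succ l))
      let i : cycObj p l ⟶ cycObj p (l + 1) := FGModuleCat.ofHom (cycMul p.asIdeal hx le_rfl)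
      have hi : x • 𝟙 (cycObj p (l + 1)) = π ≫ i := by
        apply FGModuleCat.hom_ext
        ext
        rfl
      -- Naturality moves the component to `R/pˡ`, where by induction it is a multiple of a class
      -- that `i` kills.
      rw [smul_eq_stalkMap_comp, hi, stalkMap_comp, Category.assoc, centerApp_naturality]
      rcases Nat.eq_zero_or_pos l with rfl | hpos
      · have hπ : 𝟙 (cycObj p 0) = 0 := by
          rw [← one_smul R (𝟙 (cycObj p 0))]
          exact smul_id_cycObj_eq_zero (by simp)
        have : π = 0 := by rw [← Category.comp_id π, hπ, Limits.comp_zero]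
        rw [this, stalkMap_zero, Limits.zero_comp]
      · obtain ⟨r, hr⟩ := ih hpos.ne'
        rw [hr, Linear.smul_comp, tubeClass_comp_stalkMap hx hx' hpos.ne' (by omega), smul_zero,
          Limits.comp_zero]
    have : a = (a - x * d) + d * x := by ring
    rw [this, add_smul, mul_smul, h₁, h₂, smul_zero, add_zero]

lemma centerDegree_one_eq_zero {η : centerDegree (DbMod.{w} R) 1}
    (h : ∀ (p : HeightOneSpectrum R) (l : ℕ+), centerApp η (stalk (cycObj p l)) = 0) : η = 0 := by
  refine center_eq_zero_of_gen fun i => ?_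
  rcases i with - | ⟨p, l⟩
  · have : Projective (gen R none) := projective_fg_of_projective (FGModuleCat.of R R)
    exact stalk_hom_shift_eq_zero (gen R none) (gen R none) 1 (Or.inr (by simp)) _
  · exact h p l

end CenterDedekind

/-! ### From graded pieces to a trivial extension -/

section TrivialExtensionOfDegrees

variable {C : Type u} [Category.{v} C] [Preadditive C] [HasShift C ℤ]
  [∀ n : ℤ, (shiftFunctor C n).Additive]

lemma of_mul {m n c : ℤ} (h : m + n = c) (η : centerDegree C m) (ζ : centerDegree C n) :
    GradedCenter.of m η * GradedCenter.of n ζ = GradedCenter.of c (centerMul h η ζ) := by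
  subst h
  exact DirectSum.of_mul_of (A := fun n : ℤ => centerDegree C n) η ζ

variable (C) in
/-- The data which identify the graded center with a trivial extension. -/
structure CenterTrivialExtension (A M : Type*) [CommRing A] [AddCommGroup M] [Module A M] where
  /-- The identification in degree zero. -/
  scalar : A ≃+ centerDegree C 0
  /-- The identification in degree one. -/
  residue : M ≃+ centerDegree C 1
  scalar_one : scalar 1 = centerOne
  scalar_mul_scalar (r s : A) : centerMul (zero_add 0) (scalar r) (scalar s) = scalar (r * s)
  scalar_mul_residue (r : A) (m : M) :
    centerMul (zero_add 1) (scalar r) (residue m) = residue (r • m)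
  residue_mul_scalar (m : M) (r : A) :
    centerMul (add_zero 1) (residue m) (scalar r) = residue (r • m)
  eq_zero (n : ℤ) (h₀ : n ≠ 0) (h₁ : n ≠ 1) (η : centerDegree C n) : η = 0

namespace CenterTrivialExtension

variable {A M : Type*} [CommRing A] [AddCommGroup M] [Module A M] [Module Aᵐᵒᵖ M]
  [IsCentralScalar A M] (D : CenterTrivialExtension C A M)

/-- The homomorphism from the trivial extension to the graded center. -/
def hom : TrivSqZeroExt A M →+* GradedCenter C :=
  RingHom.mk'
    { toFun := fun t => GradedCenter.of 0 (D.scalar t.fst) + GradedCenter.of 1 (D.residue t.snd)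
      map_one' := by
        rw [TrivSqZeroExt.fst_one, TrivSqZeroExt.snd_one, map_zero, map_zero, add_zero,
          D.scalar_one]
        rfl
      map_mul' := fun s t => by
        -- Products of degree one elements land in degree two, which is zero.
        have h (η ζ : centerDegree C 1) : centerMul (show (1 : ℤ) + 1 = 2 from rfl) η ζ = 0 :=
          D.eq_zero 2 (by norm_num) (by norm_num) _
        rw [add_mul, mul_add, mul_add, of_mul (zero_add 0), of_mul (zero_add 1),
          of_mul (add_zero 1), of_mul (show (1 : ℤ) + 1 = 2 from rfl), h, map_zero, add_zero,
          D.scalar_mul_scalar, D.scalar_mul_residue, D.residue_mul_scalar, add_assoc,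
          ← map_add, ← map_add, TrivSqZeroExt.fst_mul, TrivSqZeroExt.snd_mul, op_smul_eq_smul] }
    fun s t => by
      change GradedCenter.of 0 (D.scalar (s + t).fst) + GradedCenter.of 1 _ = _ + _ + (_ + _)
      rw [TrivSqZeroExt.fst_add, TrivSqZeroExt.snd_add, map_add, map_add, map_add, map_add,
        add_add_add_comm]

lemma hom_apply (t : TrivSqZeroExt A M) :
    D.hom t = GradedCenter.of 0 (D.scalar t.fst) + GradedCenter.of 1 (D.residue t.snd) := rfl

lemma hom_component_zero (t : TrivSqZeroExt A M) : D.hom t 0 = D.scalar t.fst := by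
  rw [hom_apply, DirectSum.add_apply, DirectSum.of_eq_same,
    DirectSum.of_eq_of_ne _ _ _ (by norm_num), add_zero]

lemma hom_component_one (t : TrivSqZeroExt A M) : D.hom t 1 = D.residue t.snd := by
  rw [hom_apply, DirectSum.add_apply, DirectSum.of_eq_same,
    DirectSum.of_eq_of_ne _ _ _ (by norm_num), zero_add]

lemma hom_bijective : Function.Bijective D.hom := by
  refine ⟨fun s t h => ?_, fun ζ => ?_⟩
  · refine TrivSqZeroExt.ext (D.scalar.injective ?_) (D.residue.injective ?_)
    · rw [← D.hom_component_zero, h, D.hom_component_zero]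
    · rw [← D.hom_component_one, h, D.hom_component_one]
  · obtain ⟨r, hr⟩ := D.scalar.surjective (ζ 0)
    obtain ⟨m, hm⟩ := D.residue.surjective (ζ 1)
    refine ⟨(r, m), DFinsupp.ext fun n => ?_⟩
    by_cases h₀ : n = 0
    · subst h₀
      exact (D.hom_component_zero _).trans hr
    by_cases h₁ : n = 1
    · subst h₁
      exact (D.hom_component_one _).trans hm
    exact (D.eq_zero n h₀ h₁ _).trans (D.eq_zero n h₀ h₁ _).symm

lemma hom_mem_range_iff (n : ℤ) (t : TrivSqZeroExt A M) :
    D.hom t ∈ (GradedCenter.of n).range ↔ t ∈ trivExtDegree A M n := by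
  constructor
  · rintro ⟨η, hη⟩
    refine ⟨fun h => D.scalar.injective ?_, fun h => D.residue.injective ?_⟩
    · rw [← D.hom_component_zero, ← hη, DirectSum.of_eq_of_ne _ _ _ h.symm, map_zero]
    · rw [← D.hom_component_one, ← hη, DirectSum.of_eq_of_ne _ _ _ h.symm, map_zero]
  · rintro ⟨h₀, h₁⟩
    rw [hom_apply]
    by_cases hn : n = 0
    · subst hn
      rw [h₁ (by norm_num), map_zero, map_zero, add_zero]
      exact ⟨_, rfl⟩
    rw [h₀ hn, map_zero, map_zero, zero_add]
    by_cases hn' : n = 1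
    · subst hn'
      exact ⟨_, rfl⟩
    · rw [h₁ hn', map_zero, map_zero]
      exact zero_mem _

/-- The isomorphism between the graded center and the trivial extension. -/
def equiv : GradedCenter C ≃+* TrivSqZeroExt A M :=
  (RingEquiv.ofBijective D.hom D.hom_bijective).symm

lemma equiv_hom (t : TrivSqZeroExt A M) : D.equiv (D.hom t) = t :=
  (RingEquiv.ofBijective D.hom D.hom_bijective).symm_apply_apply t

lemma mem_range_iff (n : ℤ) (ζ : GradedCenter C) :
    ζ ∈ (GradedCenter.of n).range ↔ D.equiv ζ ∈ trivExtDegree A M n := by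
  obtain ⟨t, rfl⟩ := D.hom_bijective.2 ζ
  rw [equiv_hom, hom_mem_range_iff]

lemma scalar_fst_equiv (ζ : centerDegree C 0) :
    D.scalar (D.equiv (GradedCenter.of 0 ζ)).fst = ζ := by
  rw [← D.hom_component_zero]
  have : D.hom (D.equiv (GradedCenter.of 0 ζ)) = GradedCenter.of 0 ζ :=
    (RingEquiv.ofBijective D.hom D.hom_bijective).apply_symm_apply _
  rw [this, DirectSum.of_eq_same]

lemma residue_snd_equiv (η : centerDegree C 1) :
    D.residue (D.equiv (GradedCenter.of 1 η)).snd = η := by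
  rw [← D.hom_component_one]
  have : D.hom (D.equiv (GradedCenter.of 1 η)) = GradedCenter.of 1 η :=
    (RingEquiv.ofBijective D.hom D.hom_bijective).apply_symm_apply _
  rw [this, DirectSum.of_eq_same]

end CenterTrivialExtension

end TrivialExtensionOfDegrees

/-! ### Families of residues and the isomorphism -/

section CenterMain

open DerivedCategory

variable {R : Type u} [CommRing R] [IsDedekindDomain R]
  [HasDerivedCategory.{w} (FGModuleCat.{u} R)]
  {x : HeightOneSpectrum R → R} (hx : ∀ p, x p ∈ p.asIdeal) (hx' : ∀ p, x p ∉ p.asIdeal ^ 2)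

/-- The family of classes on the indecomposable modules which is given by a family of residues. -/
def genClass (r : HeightOneSpectrum R → ℕ+ → R) :
    ∀ i, stalk (gen R i) ⟶ (stalk (gen R i))⟦(1 : ℤ)⟧
  | none => 0
  | some i => r i.1 i.2 • tubeClass.{w} (hx i.1) (hx' i.1) i.2.ne_zero

/-- Maps from `R` are harmless since `Ext¹(R, -) = 0`; maps `R/pᵐ ⟶ R` and maps between different
primes vanish. Endomorphisms of `R/pˡ` are scalars, and for different lengths both composites with
Auslander–Reiten classes are zero. -/
lemma genClass_naturality (r : HeightOneSpectrum R → ℕ+ → R) (i j) (f : gen R i ⟶ gen R j) :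
    stalkMap f ≫ genClass.{w} hx hx' r j = genClass hx hx' r i ≫ (stalkMap f)⟦(1 : ℤ)⟧' := by
  have hproj : Projective (gen R none) := projective_fg_of_projective (FGModuleCat.of R R)
  have hz : ∀ {i j : Option (HeightOneSpectrum R × ℕ+)} (f : gen R i ⟶ gen R j), f = 0 →
      stalkMap f ≫ genClass.{w} hx hx' r j =
        genClass hx hx' r i ≫ (stalkMap f)⟦(1 : ℤ)⟧' := by
    rintro i j f rfl
    rw [stalkMap_zero, Functor.map_zero, Limits.zero_comp, Limits.comp_zero]
  rcases i with - | ⟨p, m⟩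
  · exact (stalk_hom_shift_eq_zero (gen R none) _ 1 (Or.inr (by simp)) _).trans
      (stalk_hom_shift_eq_zero (gen R none) _ 1 (Or.inr (by simp)) _).symm
  rcases j with - | ⟨q, l⟩
  · exact hz f (FGModuleCat.hom_ext (cyc_hom_self_eq_zero p f.hom.hom))
  by_cases hpq : p = q
  swap
  · exact hz f (FGModuleCat.hom_ext (cyc_hom_eq_zero hpq f.hom.hom))
  subst hpq
  by_cases hml : m = l
  · subst hml
    obtain ⟨c, rfl⟩ : ∃ c : R, f = c • 𝟙 (gen R (some (p, m))) := cycObj_end_eq_smul f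
    rw [stalkMap_smul, stalkMap_id, Functor.map_smul, CategoryTheory.Functor.map_id,
      Linear.smul_comp, Linear.comp_smul, Category.id_comp, Category.comp_id]
  · have hne : (m : ℕ) ≠ l := fun h => hml (PNat.coe_injective h)
    have key (f : cycObj p m ⟶ cycObj p l) :
        stalkMap f ≫ (r p l • tubeClass.{w} (hx p) (hx' p) l.ne_zero) =
          (r p m • tubeClass.{w} (hx p) (hx' p) m.ne_zero) ≫ (stalkMap f)⟦(1 : ℤ)⟧' := by
      rw [Linear.comp_smul, Linear.smul_comp, stalkMap_comp_tubeClass _ _ _ hne,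
        tubeClass_comp_stalkMap _ _ _ hne.symm, smul_zero, smul_zero]
    exact key f

lemma exists_center_of_residues (r : HeightOneSpectrum R → ℕ+ → R) :
    ∃ η : centerDegree (DbMod.{w} R) 1, ∀ (p : HeightOneSpectrum R) (l : ℕ+),
      centerApp η (stalk (cycObj p l)) = r p l • tubeClass.{w} (hx p) (hx' p) l.ne_zero := by
  obtain ⟨τ, hτ⟩ := exists_natTrans_extending (F := stalkFunctor (FGModuleCat.{u} R))
    (G := stalkFunctor (FGModuleCat.{u} R) ⋙ shiftFunctor (DbMod.{w} R) (1 : ℤ))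
    sumThrough_gen (genClass.{w} hx hx' r) (genClass_naturality hx hx' r)
  obtain ⟨η, hη⟩ := exists_center_extending (fun M => τ.app M) fun M N f => τ.naturality f
  exact ⟨η, fun p l => (hη _).trans (hτ (some (p, l)))⟩

lemma smul_tubeClass_eq_iff (p : HeightOneSpectrum R) {l : ℕ} (hl : l ≠ 0) (r s : R) :
    r • tubeClass.{w} (hx p) (hx' p) hl = s • tubeClass (hx p) (hx' p) hl ↔
      Ideal.Quotient.mk p.asIdeal r = Ideal.Quotient.mk p.asIdeal s := by
  rw [← sub_eq_zero, ← sub_smul, smul_tubeClass_eq_zero_iff, Ideal.Quotient.mk_eq_mk_iff_sub_mem]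

/-- The element of degree one in the graded center is given on `R/pˡ` by the multiple `t p l` of the
class of the Auslander-Reiten sequence. -/
def HasResidues (η : centerDegree (DbMod.{w} R) 1) (t : ResidueProduct R) : Prop :=
  ∀ (p : HeightOneSpectrum R) (l : ℕ+) (r : R), Ideal.Quotient.mk p.asIdeal r = t p l →
    centerApp η (stalk (cycObj p l)) = r • tubeClass.{w} (hx p) (hx' p) l.ne_zero

lemma exists_hasResidues (t : ResidueProduct R) : ∃ η, HasResidues.{w} hx hx' η t := by
  choose r hr using fun (p : HeightOneSpectrum R) (l : ℕ+) => Ideal.Quotient.mk_surjective (t p l)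
  obtain ⟨η, hη⟩ := exists_center_of_residues.{w} hx hx' r
  refine ⟨η, fun p l s hs => ?_⟩
  rw [hη, smul_tubeClass_eq_iff, hr, hs]

lemma exists_residues (η : centerDegree (DbMod.{w} R) 1) :
    ∃ t : ResidueProduct R, HasResidues hx hx' η t := by
  choose r hr using fun (p : HeightOneSpectrum R) (l : ℕ+) =>
    exists_centerApp_eq_smul_tubeClass (hx p) (hx' p) η l l.ne_zero
  refine ⟨fun p l => Ideal.Quotient.mk _ (r p l), fun p l s hs => ?_⟩
  rw [hr, smul_tubeClass_eq_iff, hs]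

variable {hx hx'}

lemma HasResidues.left_unique {η ζ : centerDegree (DbMod.{w} R) 1} {t : ResidueProduct R}
    (hη : HasResidues hx hx' η t) (hζ : HasResidues hx hx' ζ t) : η = ζ := by
  rw [← sub_eq_zero]
  refine centerDegree_one_eq_zero fun p l => ?_
  obtain ⟨r, hr⟩ := Ideal.Quotient.mk_surjective (t p l)
  change centerApp η (stalk (cycObj p l)) - centerApp ζ (stalk (cycObj p l)) = 0
  rw [hη p l r hr, hζ p l r hr, sub_self]

lemma HasResidues.right_unique {η : centerDegree (DbMod.{w} R) 1} {s t : ResidueProduct R}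
    (hs : HasResidues hx hx' η s) (ht : HasResidues hx hx' η t) : s = t := by
  funext p l
  obtain ⟨a, ha⟩ := Ideal.Quotient.mk_surjective (s p l)
  obtain ⟨b, hb⟩ := Ideal.Quotient.mk_surjective (t p l)
  rw [← ha, ← hb, ← smul_tubeClass_eq_iff.{w} hx hx' p l.ne_zero, ← hs p l a ha, ht p l b hb]

lemma HasResidues.add {η ζ : centerDegree (DbMod.{w} R) 1} {s t : ResidueProduct R}
    (hs : HasResidues hx hx' η s) (ht : HasResidues hx hx' ζ t) :
    HasResidues hx hx' (η + ζ) (s + t) := by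
  intro p l r hr
  obtain ⟨a, ha⟩ := Ideal.Quotient.mk_surjective (s p l)
  obtain ⟨b, hb⟩ := Ideal.Quotient.mk_surjective (t p l)
  rw [centerApp_add, hs p l a ha, ht p l b hb, ← add_smul, smul_tubeClass_eq_iff, hr, map_add, ha,
    hb]
  rfl

lemma HasResidues.smul {η : centerDegree (DbMod.{w} R) 1} {t : ResidueProduct R}
    (ht : HasResidues hx hx' η t) (c : R) : HasResidues hx hx' (centerSMul c η) (c • t) := by
  intro p l r hr
  obtain ⟨a, ha⟩ := Ideal.Quotient.mk_surjective (t p l)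
  rw [centerApp_smul, ht p l a ha, ← mul_smul, smul_tubeClass_eq_iff, hr, map_mul, ha]
  rfl

variable (hx hx')

/-- The element of degree one in the graded center which corresponds to a family of residues. -/
def centerOfResidues : ResidueProduct R →+ centerDegree (DbMod.{w} R) 1 :=
  AddMonoidHom.mk' (fun t => (exists_hasResidues hx hx' t).choose) fun s t =>
    (exists_hasResidues hx hx' (s + t)).choose_spec.left_unique
      ((exists_hasResidues hx hx' s).choose_spec.add (exists_hasResidues hx hx' t).choose_spec)

lemma hasResidues_centerOfResidues (t : ResidueProduct R) :
    HasResidues.{w} hx hx' (centerOfResidues hx hx' t) t :=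
  (exists_hasResidues hx hx' t).choose_spec

lemma centerOfResidues_smul (c : R) (t : ResidueProduct R) :
    centerOfResidues.{w} hx hx' (c • t) = centerSMul c (centerOfResidues hx hx' t) :=
  (hasResidues_centerOfResidues hx hx' _).left_unique
    ((hasResidues_centerOfResidues hx hx' t).smul c)

lemma centerOfResidues_bijective : Function.Bijective (centerOfResidues.{w} hx hx') := by
  refine ⟨fun s t h => ?_, fun η => ?_⟩
  · exact (h ▸ hasResidues_centerOfResidues hx hx' s).right_unique
      (hasResidues_centerOfResidues.{w} hx hx' t)
  · obtain ⟨t, ht⟩ := exists_residues hx hx' η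
    exact ⟨t, (hasResidues_centerOfResidues hx hx' t).left_unique ht⟩

/-! ### The isomorphism -/

lemma centerMul_centerScalar {n : ℤ} (η : centerDegree (DbMod.{w} R) n) (r : R) :
    centerMul (add_zero n) η (centerScalar r) = centerSMul r η :=
  centerDegree_ext fun X => centerMul_smul_one (add_zero n) rfl r η X

lemma centerScalar_centerMul {n : ℤ} (η : centerDegree (DbMod.{w} R) n) (r : R) :
    centerMul (zero_add n) (centerScalar r) η = centerSMul r η :=
  centerDegree_ext fun X => centerMul_smul_one' (zero_add n) rfl r η X

/-- The graded center of the bounded derived category of a Dedekind domain is a trivial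
extension. -/
def centerTrivialExtension :
    CenterTrivialExtension (DbMod.{w} R) R (ResidueProduct R) where
  scalar := AddEquiv.ofBijective (AddMonoidHom.mk' centerScalar
    fun _ _ => centerDegree_ext fun _ => add_smul _ _ _)
    ⟨centerScalar_injective, centerScalar_surjective⟩
  residue := AddEquiv.ofBijective (centerOfResidues hx hx') (centerOfResidues_bijective hx hx')
  scalar_one := centerDegree_ext fun _ => one_smul _ _
  scalar_mul_scalar r _ := (centerScalar_centerMul _ r).trans
    (centerDegree_ext fun _ => (mul_smul _ _ _).symm)
  scalar_mul_residue r m :=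
    (centerScalar_centerMul _ r).trans (centerOfResidues_smul hx hx' r m).symm
  residue_mul_scalar m r :=
    (centerMul_centerScalar _ r).trans (centerOfResidues_smul hx hx' r m).symm
  eq_zero _ h₀ h₁ η := center_eq_zero_of_ne h₀ h₁ η

end CenterMain

end KrauseYe

end

theorem proposition3p6 {R : Type u} [CommRing R] [IsDedekindDomain R]
    [HasDerivedCategory.{w} (FGModuleCat.{u} R)]
    (x : IsDedekindDomain.HeightOneSpectrum R → R)
    (hx : ∀ p, x p ∈ p.asIdeal) (hx' : ∀ p, x p ∉ p.asIdeal ^ 2) :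
    ∃ hσ : ∀ (p : IsDedekindDomain.HeightOneSpectrum R) (l : ℕ+),
        IsAlmostSplit (pTorsion p.asIdeal) (tubeSeq p.asIdeal (hx p) l),
    ∃ e : GradedCenter (DbMod.{w} R) ≃+* TrivSqZeroExt R (ResidueProduct R),
      (∀ (n : ℤ) (ζ : GradedCenter (DbMod.{w} R)),
        ζ ∈ (GradedCenter.of n).range ↔ e ζ ∈ trivExtDegree R (ResidueProduct R) n) ∧
      (∀ (ζ : centerDegree (DbMod.{w} R) 0) (X : DbMod.{w} R),
        centerApp ζ X = ShiftedHom.mk₀ (0 : ℤ) rfl ((e (GradedCenter.of 0 ζ)).fst • 𝟙 X)) ∧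
      (∀ (η : centerDegree (DbMod.{w} R) 1) (p : IsDedekindDomain.HeightOneSpectrum R)
        (l : ℕ+) (r : R),
        Ideal.Quotient.mk p.asIdeal r = (e (GradedCenter.of 1 η)).snd p l →
        centerApp η (stalk (FGModuleCat.of R (cyc p.asIdeal l))) =
          r • extClass (hσ p l).shortExact) := by
  let D := centerTrivialExtension hx hx'
  refine ⟨fun p l => tubeSeq_isAlmostSplit p (hx p) (hx' p) l.ne_zero, D.equiv, D.mem_range_iff,
    fun ζ X => ?_, fun η p l r hr => ?_⟩
  · exact (congr_arg (centerApp · X) (D.scalar_fst_equiv ζ)).symm.trans (centerApp_scalar _ X)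
  · exact (congr_arg (centerApp · (stalk (cycObj p l))) (D.residue_snd_equiv η)).symm.trans
      (hasResidues_centerOfResidues hx hx' _ p l r hr)
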